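/- Let $\mathrm{E}=\{(0),(ij),(k)\mid 1\le i<j\le 5,\ 1\le k\le 5\}$ be the set of the sixteen weights of the half-spin representation of $\mathrm{Spin}(10)$, and let $\hat{\mathrm{E}}=\{\alpha^r\mid \alpha\in\mathrm{E},\ r\in\mathbb{Z}\}$. Order $\hat{\mathrm{E}}$ by the existence of directed paths in the graph with, for every $r\in\mathbb{Z}$, the arrows \[(0)\to(12)\to(13)\to(23)\to(24)\to(34)\to(5)\to(4)\to(3)\to(2)\to(1),\quad (13)\to(14)\to(24),\quad (14)\to(15)\to(25),\] \[(24)\to(25)\to(35)\to(4),\quad (34)\to(35)\to(45)\to(3)\] (all labels at level $r$), and $(45)^r\to(0)^{r+1}$, $(3)^r\to(12)^{r+1}$, $(2)^r\to(13)^{r+1}$, $(1)^r\to(23)^{r+1}$. The cone of pure spinors is defined in the variables $\lambda^{(0)}=\lambda$, $\lambda^{(ij)}=w_{ij}=-w_{ji}$, $\lambda^{(k)}=p_k$ by the ten quadrics $\lambda p_i+\mathrm{Pf}_i(w)$ and $\sum_{j=1}^5(-1)^j w_{ij}p_j$, $i=1,\dots,5$, where $\mathrm{Pf}_i(w)=w_{ab}w_{cd}-w_{ac}w_{bd}+w_{ad}w_{bc}$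 for $\{a<b<c<d\}=\{1,\dots,5\}\setminus\{i\}$. For $\hat\gamma,\hat\delta\in\hat{\mathrm{E}}$ let $A_{\hat\gamma}^{\hat\delta}$ be the quotient of the polynomial algebra over $\mathbb{C}$ with generators $\lambda^{\alpha^l}$, $\alpha^l\in[\hat\gamma,\hat\delta]$, by all coefficients of all powers of $x$ in these ten quadrics evaluated at the series $\lambda^\alpha(x)=\sum_{\alpha^l\in[\hat\gamma,\hat\delta]}\lambda^{\alpha^l}x^l$. Let $z=(z_1,\dots,z_5)\in(\mathbb{C}^\times)^5$ together with a chosen square root $\det^{1/2}(z)$ of $z_1\cdots z_5$ be a point of the maximal torus of $\mathrm{Spin}(10)$, put \[e_0=\textstyle\det^{-1/2}(z),\qquad e_{ij}=\det^{-1/2}(z)\,z_iz_j,\qquad e_k=\det^{1/2}(z)\,z_k^{-1},\] and let $(z,q)$, $q\in\mathbb{C}^\times$, act on $A_{\hat\gamma}^{\hat\delta}$ by the algebra automorphism $\lambda^{\alpha^l}\mapsto q^le_\alpha\lambda^{\alpha^l}$. Let $A_{\hat\gamma}^{\hat\delta}(t)=\sum_{n\ge0}a_n(z,q)t^n$, where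 $a_n(z,q)$ is the trace of $(z,q)$ on the component of degree $n$ of $A_{\hat\gamma}^{\hat\delta}$. Then, for all such $z,q$, all $r\in\mathbb{Z}$ and all $\hat\gamma\in\hat{\mathrm{E}}$, the following identities of power series in $t$ hold. If $\hat\gamma<(1)^{r-1}$, then \[A_{\hat\gamma}^{(5)^r}(t)=\frac{\left(1-e_{15}q^rt-e_{14}e_{23}q^{2r}t^2+e_{15}e_{14}e_{23}q^{3r}t^3\right)A_{\hat\gamma}^{(15)^r}(t)+e_1q^{r-1}t\,A_{\hat\gamma}^{(1)^{r-1}}(t)}{(1-e_{24}q^rt)(1-e_{34}q^rt)(1-e_5q^rt)(1-e_{23}q^rt)}.\] If $\hat\gamma<(0)^{r}$, then \[A_{\hat\gamma}^{(15)^r}(t)=\frac{\left(1-e_1q^{r-1}t-e_2e_{12}q^{2r-1}t^2+e_1e_2e_{12}q^{3r-2}t^3\right)A_{\hat\gamma}^{(1)^{r-1}}(t)+e_0q^rt\,A_{\hat\gamma}^{(0)^r}(t)}{(1-e_{13}q^rt)(1-e_{14}q^rt)(1-e_{15}q^rt)(1-e_{12}q^rt)}.\] If $\hat\gamma<(5)^{r}$,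 then \[A_{\hat\gamma}^{(1)^r}(t)=\frac{\left(1-e_0q^{r+1}t-e_{45}e_4q^{2r}t^2+e_0e_{45}e_4q^{3r+1}t^3\right)A_{\hat\gamma}^{(0)^{r+1}}(t)+e_5q^rt\,A_{\hat\gamma}^{(5)^r}(t)}{(1-e_3q^rt)(1-e_2q^rt)(1-e_1q^rt)(1-e_4q^rt)}.\] If $\hat\gamma<(15)^{r-1}$, then \[A_{\hat\gamma}^{(0)^r}(t)=\frac{\left(q^3-q^{2+r}e_5t-q^{2r+1}e_{34}e_{25}t^2+q^{3r}e_{34}e_5e_{25}t^3\right)A_{\hat\gamma}^{(5)^{r-1}}(t)+q^{2+r}e_{15}t\,A_{\hat\gamma}^{(15)^{r-1}}(t)}{(q-e_{35}q^rt)(q-e_{45}q^rt)(1-e_0q^rt)(q-e_{25}q^rt)}.\] -/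

import Mathlib

open scoped BigOperators

namespace PureSpinor

/-- The sixteen weights of the spinor representation: `o` is `(0)`, `wij` is `(ij)` and `pk` is `(k)`. -/
inductive Weight : Type
  | o
  | w12 | w13 | w14 | w15 | w23 | w24 | w25 | w34 | w35 | w45
  | p1 | p2 | p3 | p4 | p5

/-- The affine weights `α^l = (α, l)`. -/
@[ext]
structure AffWeight : Type where
  wt : Weight
  lev : ℤ

open Weight

/-- The arrows of the Hasse diagram of the affine weights: the twenty arrows of the diagram of the
spinor representation in every level, and four arrows from each level to the next one. -/
inductive Arrow : AffWeight → AffWeight → Prop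
  | a01 (r : ℤ) : Arrow ⟨o, r⟩ ⟨w12, r⟩
  | a02 (r : ℤ) : Arrow ⟨w12, r⟩ ⟨w13, r⟩
  | a03 (r : ℤ) : Arrow ⟨w13, r⟩ ⟨w23, r⟩
  | a04 (r : ℤ) : Arrow ⟨w13, r⟩ ⟨w14, r⟩
  | a05 (r : ℤ) : Arrow ⟨w23, r⟩ ⟨w24, r⟩
  | a06 (r : ℤ) : Arrow ⟨w14, r⟩ ⟨w24, r⟩
  | a07 (r : ℤ) : Arrow ⟨w14, r⟩ ⟨w15, r⟩
  | a08 (r : ℤ) : Arrow ⟨w24, r⟩ ⟨w34, r⟩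
  | a09 (r : ℤ) : Arrow ⟨w24, r⟩ ⟨w25, r⟩
  | a10 (r : ℤ) : Arrow ⟨w15, r⟩ ⟨w25, r⟩
  | a11 (r : ℤ) : Arrow ⟨w34, r⟩ ⟨p5, r⟩
  | a12 (r : ℤ) : Arrow ⟨w34, r⟩ ⟨w35, r⟩
  | a13 (r : ℤ) : Arrow ⟨w25, r⟩ ⟨w35, r⟩
  | a14 (r : ℤ) : Arrow ⟨p5, r⟩ ⟨p4, r⟩
  | a15 (r : ℤ) : Arrow ⟨w35, r⟩ ⟨p4, r⟩
  | a16 (r : ℤ) : Arrow ⟨w35, r⟩ ⟨w45, r⟩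
  | a17 (r : ℤ) : Arrow ⟨p4, r⟩ ⟨p3, r⟩
  | a18 (r : ℤ) : Arrow ⟨w45, r⟩ ⟨p3, r⟩
  | a19 (r : ℤ) : Arrow ⟨p3, r⟩ ⟨p2, r⟩
  | a20 (r : ℤ) : Arrow ⟨p2, r⟩ ⟨p1, r⟩
  | b1 (r : ℤ) : Arrow ⟨w45, r⟩ ⟨o, r + 1⟩
  | b2 (r : ℤ) : Arrow ⟨p3, r⟩ ⟨w12, r + 1⟩
  | b3 (r : ℤ) : Arrow ⟨p2, r⟩ ⟨w13, r + 1⟩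
  | b4 (r : ℤ) : Arrow ⟨p1, r⟩ ⟨w23, r + 1⟩

/-- The height of a weight of level zero. -/
def Weight.ht : Weight → ℤ
  | o => 0 | w12 => 1 | w13 => 2 | w14 => 3 | w23 => 3 | w15 => 4 | w24 => 4 | w25 => 5
  | w34 => 5 | w35 => 6 | p5 => 6 | w45 => 7 | p4 => 7 | p3 => 8 | p2 => 9 | p1 => 10

/-- The height of an affine weight. -/
def AffWeight.ht (x : AffWeight) : ℤ := 8 * x.lev + x.wt.ht

theorem Arrow.ht_succ {x y : AffWeight} (h : Arrow x y) : y.ht = x.ht + 1 := by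
  cases h <;> simp [AffWeight.ht, Weight.ht] <;> ring

theorem Arrow.lev_le {x y : AffWeight} (h : Arrow x y) : x.lev ≤ y.lev := by
  cases h <;> simp

theorem eq_or_ht_lt {x y : AffWeight} (h : Relation.ReflTransGen Arrow x y) :
    x = y ∨ x.ht < y.ht := by
  induction h with
  | refl => exact Or.inl rfl
  | tail _ h ih =>
    right
    have := h.ht_succ
    rcases ih with rfl | ih <;> omega

/-- `x ≤ y` means that there is a directed path from `x` to `y`. -/
instance : PartialOrder AffWeight where
  le := Relation.ReflTransGen Arrow
  le_refl _ := Relation.ReflTransGen.refl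
  le_trans _ _ _ := Relation.ReflTransGen.trans
  le_antisymm x y h h' := by
    rcases eq_or_ht_lt h with h | h
    · exact h
    · rcases eq_or_ht_lt h' with h' | h'
      · exact h'.symm
      · omega

theorem lev_mono {x y : AffWeight} (h : x ≤ y) : x.lev ≤ y.lev := by
  have h : Relation.ReflTransGen Arrow x y := h
  induction h with
  | refl => exact le_rfl
  | tail h1 h2 ih => exact le_trans (ih h1) h2.lev_le

/-- The ten quadrics that define the cone of pure spinors, as lists of terms `(c, α, β)` that stand
for `c * λ^α * λ^β`. `Sum.inl i` is the quadric labelled by the vector `v_{i+1}`, and `Sum.inr i` the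
one labelled by the dual vector. -/
def quadric : Fin 5 ⊕ Fin 5 → List (ℤ × Weight × Weight)
  | .inl 0 => [(1, o, p1), (1, w25, w34), (-1, w24, w35), (1, w23, w45)]
  | .inl 1 => [(-1, o, p2), (-1, w15, w34), (1, w14, w35), (-1, w13, w45)]
  | .inl 2 => [(1, o, p3), (1, w15, w24), (-1, w14, w25), (1, w12, w45)]
  | .inl 3 => [(-1, o, p4), (-1, w15, w23), (1, w13, w25), (-1, w12, w35)]
  | .inl 4 => [(1, o, p5), (1, w14, w23), (-1, w13, w24), (1, w12, w34)]
  | .inr 0 => [(-1, p2, w12), (1, p3, w13), (-1, p4, w14), (1, p5, w15)]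
  | .inr 1 => [(-1, p1, w12), (1, p3, w23), (-1, p4, w24), (1, p5, w25)]
  | .inr 2 => [(-1, p1, w13), (1, p2, w23), (-1, p4, w34), (1, p5, w35)]
  | .inr 3 => [(-1, p1, w14), (1, p2, w24), (-1, p3, w34), (1, p5, w45)]
  | .inr 4 => [(-1, p1, w15), (1, p2, w25), (-1, p3, w35), (1, p4, w45)]

noncomputable section

/-- The polynomial algebra with one generator for each element of the interval `[γ, δ]`. -/
abbrev PolyAlg (γ δ : AffWeight) : Type := MvPolynomial (Set.Icc γ δ) ℂ

open Classical in
/-- The generator with label `x`, where `x` in `[γ, δ]`, and `0` for all other `x`. -/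
def gen (γ δ x : AffWeight) : PolyAlg γ δ :=
  if h : x ∈ Set.Icc γ δ then MvPolynomial.X ⟨x, h⟩ else 0

/-- The coefficient of `z ^ l` in `λ^α(z) * λ^β(z)`, where `λ^α(z) = ∑ λ^(α^a) z ^ a` over all `a`
with `α^a` in `[γ, δ]`; all these levels `a` lie between those of `γ` and `δ`. -/
def prodCoeff (γ δ : AffWeight) (α β : Weight) (l : ℤ) : PolyAlg γ δ :=
  ∑ a ∈ Finset.Icc γ.lev δ.lev, gen γ δ ⟨α, a⟩ * gen γ δ ⟨β, l - a⟩

theorem gen_eq_zero {γ δ : AffWeight} {α : Weight} {a : ℤ} (h : a ∉ Finset.Icc γ.lev δ.lev) :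
    gen γ δ ⟨α, a⟩ = 0 := by
  apply dif_neg
  rintro ⟨h1, h2⟩
  exact h (Finset.mem_Icc.2 ⟨lev_mono h1, lev_mono h2⟩)

/-- The coefficient of `z ^ l` in the quadric with label `s` evaluated at the series `λ^α(z)`. -/
def relation (γ δ : AffWeight) (s : Fin 5 ⊕ Fin 5) (l : ℤ) : PolyAlg γ δ :=
  ((quadric s).map fun m => (m.1 : PolyAlg γ δ) * prodCoeff γ δ m.2.1 m.2.2 l).sum

/-- The ideal generated by all the relations. -/
def relIdeal (γ δ : AffWeight) : Ideal (PolyAlg γ δ) :=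
  Ideal.span (Set.range fun m : (Fin 5 ⊕ Fin 5) × ℤ => relation γ δ m.1 m.2)

/-- The algebra `A_γ^δ`. -/
abbrev RichardsonAlg (γ δ : AffWeight) : Type := PolyAlg γ δ ⧸ relIdeal γ δ

/-- The component of degree `n` of `A_γ^δ`: the classes of homogeneous polynomials of degree `n`. -/
def gradedPart (γ δ : AffWeight) (n : ℕ) : Submodule ℂ (RichardsonAlg γ δ) :=
  (MvPolynomial.homogeneousSubmodule (Set.Icc γ δ) ℂ n).map
    (Ideal.Quotient.mkₐ ℂ (relIdeal γ δ)).toLinearMap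

/-- A point of the maximal torus of `Spin(10)`, the two-sheeted cover of the diagonal torus of
`GL(5)`: a diagonal matrix `z` with a square root of its determinant. -/
structure SpinTorus : Type where
  z : Fin 5 → ℂˣ
  sqrtDet : ℂˣ
  sqrtDet_sq : sqrtDet ^ 2 = ∏ i, z i

/-- The weights of the spinor representation as functions on the torus:
`det(z)^(-1/2)`, `det(z)^(-1/2) z_i z_j` and `det(z)^(1/2) z_k⁻¹`. -/
def SpinTorus.e (τ : SpinTorus) : Weight → ℂˣ
  | o => τ.sqrtDet⁻¹
  | w12 => τ.sqrtDet⁻¹ * (τ.z 0 * τ.z 1)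
  | w13 => τ.sqrtDet⁻¹ * (τ.z 0 * τ.z 2)
  | w14 => τ.sqrtDet⁻¹ * (τ.z 0 * τ.z 3)
  | w15 => τ.sqrtDet⁻¹ * (τ.z 0 * τ.z 4)
  | w23 => τ.sqrtDet⁻¹ * (τ.z 1 * τ.z 2)
  | w24 => τ.sqrtDet⁻¹ * (τ.z 1 * τ.z 3)
  | w25 => τ.sqrtDet⁻¹ * (τ.z 1 * τ.z 4)
  | w34 => τ.sqrtDet⁻¹ * (τ.z 2 * τ.z 3)
  | w35 => τ.sqrtDet⁻¹ * (τ.z 2 * τ.z 4)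
  | w45 => τ.sqrtDet⁻¹ * (τ.z 3 * τ.z 4)
  | p1 => τ.sqrtDet * (τ.z 0)⁻¹
  | p2 => τ.sqrtDet * (τ.z 1)⁻¹
  | p3 => τ.sqrtDet * (τ.z 2)⁻¹
  | p4 => τ.sqrtDet * (τ.z 3)⁻¹
  | p5 => τ.sqrtDet * (τ.z 4)⁻¹

/-- The scalar by which the point `(τ, q)` acts on the generator with label `α^l`. -/
def SpinTorus.affE (τ : SpinTorus) (q : ℂˣ) (x : AffWeight) : ℂˣ := q ^ x.lev * τ.e x.wt

/-- The action of `(τ, q)` on the polynomial algebra. -/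
def polyAct (γ δ : AffWeight) (τ : SpinTorus) (q : ℂˣ) : PolyAlg γ δ →ₐ[ℂ] PolyAlg γ δ :=
  MvPolynomial.aeval fun x => MvPolynomial.C ((τ.affE q x : ℂˣ) : ℂ) * MvPolynomial.X x

/-- The weights of the quadrics. -/
def SpinTorus.v (τ : SpinTorus) : Fin 5 ⊕ Fin 5 → ℂˣ
  | .inl i => (τ.z i)⁻¹
  | .inr i => τ.z i

theorem e_mul_e (τ : SpinTorus) (s : Fin 5 ⊕ Fin 5) :
    ∀ m ∈ quadric s, τ.e m.2.1 * τ.e m.2.2 = τ.v s := by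
  obtain ⟨z, d, h⟩ := τ
  rw [Fin.prod_univ_five] at h
  have h' : ((d : ℂ)) ^ 2 = z 0 * z 1 * z 2 * z 3 * z 4 := by exact_mod_cast congrArg Units.val h
  have hd := d.ne_zero
  have h0 := (z 0).ne_zero
  have h1 := (z 1).ne_zero
  have h2 := (z 2).ne_zero
  have h3 := (z 3).ne_zero
  have h4 := (z 4).ne_zero
  rcases s with s | s <;> fin_cases s <;>
    simp only [quadric, List.forall_mem_cons, SpinTorus.e, SpinTorus.v, Fin.zero_eta, Fin.mk_one,
      Fin.reduceFinMk, List.not_mem_nil, false_imp_iff, implies_true, and_true] <;>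
    refine ⟨?_, ?_, ?_, ?_⟩ <;> ext <;> push_cast <;> field_simp <;> rw [h'] <;> ring

theorem polyAct_gen (γ δ : AffWeight) (τ : SpinTorus) (q : ℂˣ) (x : AffWeight) :
    polyAct γ δ τ q (gen γ δ x) = MvPolynomial.C ((τ.affE q x : ℂˣ) : ℂ) * gen γ δ x := by
  by_cases h : x ∈ Set.Icc γ δ <;> simp [gen, h, polyAct]

theorem polyAct_relation (γ δ : AffWeight) (τ : SpinTorus) (q : ℂˣ) (s : Fin 5 ⊕ Fin 5) (l : ℤ) :
    polyAct γ δ τ q (relation γ δ s l) =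
      MvPolynomial.C ((q ^ l * τ.v s : ℂˣ) : ℂ) * relation γ δ s l := by
  rw [relation, map_list_sum, ← List.sum_map_mul_left, List.map_map]
  refine congrArg List.sum (List.map_congr_left fun m hm => ?_)
  simp only [Function.comp_apply, map_mul, map_intCast, prodCoeff, map_sum, polyAct_gen,
    Finset.mul_sum]
  refine Finset.sum_congr rfl fun a _ => ?_
  have h : q ^ l * τ.v s = τ.affE q ⟨m.2.1, a⟩ * τ.affE q ⟨m.2.2, l - a⟩ := by
    rw [← e_mul_e τ s m hm, SpinTorus.affE, SpinTorus.affE, mul_mul_mul_comm, ← zpow_add]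
    simp
  rw [h, Units.val_mul, MvPolynomial.C_mul]
  ring

theorem relIdeal_le_comap (γ δ : AffWeight) (τ : SpinTorus) (q : ℂˣ) :
    relIdeal γ δ ≤ (relIdeal γ δ).comap (polyAct γ δ τ q) := by
  refine Ideal.span_le.2 ?_
  rintro _ ⟨m, rfl⟩
  change polyAct γ δ τ q (relation γ δ m.1 m.2) ∈ relIdeal γ δ
  rw [polyAct_relation]
  exact Ideal.mul_mem_left _ _ (Ideal.subset_span ⟨m, rfl⟩)

/-- The action of `(τ, q)` on `A_γ^δ`. -/
def act (γ δ : AffWeight) (τ : SpinTorus) (q : ℂˣ) : RichardsonAlg γ δ →ₐ[ℂ] RichardsonAlg γ δ :=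
  Ideal.quotientMapₐ (relIdeal γ δ) (polyAct γ δ τ q) (relIdeal_le_comap γ δ τ q)

theorem act_mem_gradedPart (γ δ : AffWeight) (τ : SpinTorus) (q : ℂˣ) (n : ℕ) :
    ∀ x ∈ gradedPart γ δ n, (act γ δ τ q).toLinearMap x ∈ gradedPart γ δ n := by
  rintro _ ⟨p, hp, rfl⟩
  refine ⟨polyAct γ δ τ q p, ?_, rfl⟩
  have h := MvPolynomial.IsHomogeneous.aeval (n := 1) (m := n) hp
    (fun x : Set.Icc γ δ =>
      MvPolynomial.C ((τ.affE q x : ℂˣ) : ℂ) * (MvPolynomial.X x : PolyAlg γ δ))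
    (fun x => by
      simpa using (MvPolynomial.isHomogeneous_C _ _).mul (MvPolynomial.isHomogeneous_X ℂ x))
  simpa [polyAct] using h

/-- The value at `(τ, q)` of the character of the component of degree `n` of `A_γ^δ`. -/
def gradedChar (γ δ : AffWeight) (τ : SpinTorus) (q : ℂˣ) (n : ℕ) : ℂ :=
  LinearMap.trace ℂ (gradedPart γ δ n)
    ((act γ δ τ q).toLinearMap.restrict (act_mem_gradedPart γ δ τ q n))

/-- The Poincaré series `A_γ^δ(z, q, t)`, a power series in `t` for each torus point `(τ, q)`. -/
def poincare (γ δ : AffWeight) (τ : SpinTorus) (q : ℂˣ) : PowerSeries ℂ :=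
  PowerSeries.mk (gradedChar γ δ τ q)

/-- The variable of the power series. -/
abbrev t : PowerSeries ℂ := PowerSeries.X

/-- The scalar `q ^ k` as a constant power series. -/
abbrev Q (q : ℂˣ) (k : ℤ) : PowerSeries ℂ := PowerSeries.C ((q : ℂ) ^ k)

/-- The scalar `e_α` as a constant power series. -/
abbrev SpinTorus.E (τ : SpinTorus) (α : Weight) : PowerSeries ℂ := PowerSeries.C ((τ.e α : ℂˣ) : ℂ)

end

end PureSpinor

open PureSpinor

/-! The relations form a Gröbner basis whose leading monomials are exactly the products of two
incomparable affine weights. Hence the monomials supported on chains of `[γ, δ]` give a basis of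
`RichardsonAlg γ δ`. The torus acts diagonally on this basis, so the Poincaré series is the weighted
generating function of the multichains in the interval (`poincare_eq_chainSeries`), and the
recursions become statements about the poset.

The poset is a strip in the plane lattice with the product order (`AffWeight.le_iff`). Exactly one
product in a relation is incomparable; all others have the same total height and enclose it, hence
have a larger sum of squared heights (`exists_lead_term`, `Straddle.sq_lt`). Giving a generator the
weight "constant minus squared height" therefore makes the incomparable product lead. In
Buchberger's criterion, coprime pairs resolve automatically, and each overlapping pair is resolved
by one of the sixteen linear syzygies of the quadrics. Periodicity in the level reduces this to a
finite check (`overlap_check`).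

Removing the top element of an interval divides out a geometric series and leaves one smaller
interval or a union of two, according to the number of lower covers. Eliminating the intermediate
series in a configuration of nine elements gives `Ladder.recursion`, and each formula is one such
configuration. -/

namespace PureSpinor

/-! ### Buchberger's criterion for a weight function in place of a monomial order -/

noncomputable section Groebner

open MvPolynomial

variable {σ J K : Type*} [Field K]

/-- The span of the multiples `x ^ m * f j` whose leading exponent `m + L j` has weight below `N`. -/
def lowSpan (w : σ → ℕ) (f : J → MvPolynomial σ K) (L : J → σ →₀ ℕ) (N : ℕ) :
    Submodule K (MvPolynomial σ K) :=
  Submodule.span K {g | ∃ m j, Finsupp.weight w (m + L j) < N ∧ monomial m 1 * f j = g}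

/-- The polynomials all of whose monomials have weight below `N`. -/
abbrev lowWeight (K : Type*) [Field K] (w : σ → ℕ) (N : ℕ) : Submodule K (MvPolynomial σ K) :=
  restrictSupport K {m | Finsupp.weight w m < N}

/-- `IsLead w f L u`: the monomial `u j * x ^ (L j)` dominates all other terms of `f j`. -/
def IsLead (w : σ → ℕ) (f : J → MvPolynomial σ K) (L : J → σ →₀ ℕ) (u : J → K) : Prop :=
  ∀ j, u j ≠ 0 ∧ f j - monomial (L j) (u j) ∈ lowWeight K w (Finsupp.weight w (L j))

variable {w : σ → ℕ} {f : J → MvPolynomial σ K} {L : J → σ →₀ ℕ} {u : J → K}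

theorem lowSpan_mono {N N' : ℕ} (h : N ≤ N') : lowSpan w f L N ≤ lowSpan w f L N' :=
  Submodule.span_mono fun _ ⟨m, j, hm, hg⟩ => ⟨m, j, hm.trans_le h, hg⟩

theorem monomial_mul_mem_lowSpan (n : σ →₀ ℕ) {N : ℕ} {p : MvPolynomial σ K}
    (hp : p ∈ lowSpan w f L N) : monomial n 1 * p ∈ lowSpan w f L (Finsupp.weight w n + N) := by
  induction hp using Submodule.span_induction with
  | mem x hx =>
    obtain ⟨m, j, hm, rfl⟩ := hx
    refine Submodule.subset_span ⟨n + m, j, ?_, ?_⟩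
    · rw [add_assoc, map_add]; omega
    · rw [← mul_assoc, monomial_mul, one_mul]
  | zero => simp
  | add x y _ _ hx hy => rw [mul_add]; exact add_mem hx hy
  | smul a x _ hx => rw [mul_smul_comm]; exact Submodule.smul_mem _ _ hx

theorem mul_mem_lowSpan {N : ℕ} {g : MvPolynomial σ K} (hg : g ∈ lowWeight K w N) (j : J) :
    g * f j ∈ lowSpan w f L (N + Finsupp.weight w (L j)) := by
  rw [lowWeight, restrictSupport_eq_span] at hg
  induction hg using Submodule.span_induction with
  | mem x hx =>
    obtain ⟨m, hm, rfl⟩ := hx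
    refine Submodule.subset_span ⟨m, j, ?_, rfl⟩
    rw [map_add]
    have : Finsupp.weight w m < N := hm
    omega
  | zero => simp
  | add x y _ _ hx hy => rw [add_mul]; exact add_mem hx hy
  | smul a x _ hx => rw [smul_mul_assoc]; exact Submodule.smul_mem _ _ hx

theorem monomial_mul_mem_lowWeight (n : σ →₀ ℕ) {N : ℕ} {p : MvPolynomial σ K}
    (hp : p ∈ lowWeight K w N) : monomial n 1 * p ∈ lowWeight K w (Finsupp.weight w n + N) := by
  rw [lowWeight, restrictSupport_eq_span] at hp
  induction hp using Submodule.span_induction with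
  | mem x hx =>
    obtain ⟨m, hm, rfl⟩ := hx
    have : Finsupp.weight w m < N := hm
    simp only [monomial_mul, one_mul]
    refine (monomial_mem_restrictSupport K).2 (Or.inl ?_)
    simp only [Set.mem_ofPred_eq, map_add]
    omega
  | zero => simp
  | add x y _ _ hx hy => rw [mul_add]; exact add_mem hx hy
  | smul a x _ hx => rw [mul_smul_comm]; exact Submodule.smul_mem _ _ hx

theorem lowWeight_mono {N N' : ℕ} (h : N ≤ N') : lowWeight K w N ≤ lowWeight K w N' :=
  restrictSupport_mono K fun _ hm => lt_of_lt_of_le hm h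

theorem IsLead.monomial_mul_sub_mem (hL : IsLead w f L u) (m : σ →₀ ℕ) (j : J) :
    monomial m 1 * f j - monomial (m + L j) (u j) ∈
      lowWeight K w (Finsupp.weight w (m + L j)) := by
  have := monomial_mul_mem_lowWeight m (hL j).2
  rwa [mul_sub, monomial_mul, one_mul, ← map_add] at this

theorem IsLead.lowSpan_le (hL : IsLead w f L u) (N : ℕ) :
    lowSpan w f L N ≤ lowWeight K w N := by
  refine Submodule.span_le.2 ?_
  rintro _ ⟨m, j, hm, rfl⟩
  have h1 := lowWeight_mono hm.le (hL.monomial_mul_sub_mem m j)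
  have h2 : monomial (m + L j) (u j) ∈ lowWeight K w N :=
    (monomial_mem_restrictSupport K).2 (Or.inl hm)
  simpa using add_mem h1 h2

/-- The condition on pairs of overlapping leading monomials in Buchberger's criterion. -/
def OverlapsResolve (w : σ → ℕ) (f : J → MvPolynomial σ K) (L : J → σ →₀ ℕ) : Prop :=
  ∀ j j', j ≠ j' → ¬ Disjoint (L j) (L j') → ∃ ε : K,
    monomial (L j' - L j) 1 * f j - ε • (monomial (L j - L j') 1 * f j') ∈
      lowSpan w f L (Finsupp.weight w (L j' - L j + L j))

/-- The product criterion: if `g`, `g'` are the tails of `f j`, `f j'`, then the leading parts are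
`f j - g` and `f j' - g'`. The products of `f j` with `f j'` cancel, which leaves `g * f j' - g' * f
j` up to a scalar. -/
theorem IsLead.coprime_mem (hL : IsLead w f L u) (j j' : J) :
    monomial (L j') 1 * f j - (u j / u j') • (monomial (L j) 1 * f j') ∈
      lowSpan w f L (Finsupp.weight w (L j' + L j)) := by
  obtain ⟨hu, hg⟩ := hL j
  obtain ⟨hu', hg'⟩ := hL j'
  set g := f j - monomial (L j) (u j) with hgdef
  set g' := f j' - monomial (L j') (u j') with hgdef'
  have e1 : monomial (L j) (u j) = u j • monomial (L j) (1 : K) := by simp [smul_monomial]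
  have e2 : monomial (L j') (u j') = u j' • monomial (L j') (1 : K) := by simp [smul_monomial]
  have key : monomial (L j') 1 * f j - (u j / u j') • (monomial (L j) 1 * f j') =
      (u j')⁻¹ • (g * f j' - g' * f j) := by
    rw [hgdef, hgdef', e1, e2]
    simp only [Algebra.smul_def, div_eq_mul_inv, map_mul]
    have : (algebraMap K (MvPolynomial σ K)) (u j')⁻¹ * algebraMap K (MvPolynomial σ K) (u j') = 1 := by
      rw [← map_mul, inv_mul_cancel₀ hu', map_one]
    linear_combination (-(monomial (L j') 1 * f j)) * this
  rw [key]
  refine Submodule.smul_mem _ _ (sub_mem ?_ ?_)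
  · have := mul_mem_lowSpan (f := f) (L := L) hg j'
    rwa [← map_add, add_comm] at this
  · have := mul_mem_lowSpan (f := f) (L := L) hg' j
    rwa [← map_add] at this

/-- Every coincidence of leading exponents for `j ≠ j'` is a monomial multiple of the minimal one,
at the least common multiple. The minimal one is either coprime or an overlap. -/
theorem exists_sub_smul_mem_lowSpan (hL : IsLead w f L u) (hS : OverlapsResolve w f L)
    {m m' : σ →₀ ℕ} {j j' : J} (h : m + L j = m' + L j') : ∃ ε : K,
    monomial m 1 * f j - ε • (monomial m' 1 * f j') ∈
      lowSpan w f L (Finsupp.weight w (m + L j)) := by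
  by_cases hjj : j = j'
  · subst hjj
    obtain rfl := add_right_cancel h
    exact ⟨1, by simp⟩
  have hle : L j' - L j ≤ m := by
    intro i
    have := DFunLike.congr_fun h i
    simp only [Finsupp.coe_add, Pi.add_apply, Finsupp.tsub_apply] at this ⊢
    omega
  obtain ⟨n, rfl⟩ := exists_add_of_le hle
  have hm' : m' = L j - L j' + n := by
    ext i
    have := DFunLike.congr_fun h i
    simp only [Finsupp.coe_add, Pi.add_apply, Finsupp.tsub_apply] at this ⊢
    omega
  subst hm'
  obtain ⟨ε, hε⟩ : ∃ ε : K,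
      monomial (L j' - L j) 1 * f j - ε • (monomial (L j - L j') 1 * f j') ∈
        lowSpan w f L (Finsupp.weight w (L j' - L j + L j)) := by
    by_cases hd : Disjoint (L j) (L j')
    · have h1 : L j' - L j = L j' := by
        ext i
        have := DFunLike.congr_fun (disjoint_iff.1 hd) i
        simp only [Finsupp.inf_apply, Finsupp.tsub_apply, bot_eq_zero, Finsupp.coe_zero,
          Pi.zero_apply] at this ⊢
        omega
      have h2 : L j - L j' = L j := by
        ext i
        have := DFunLike.congr_fun (disjoint_iff.1 hd) i
        simp only [Finsupp.inf_apply, Finsupp.tsub_apply, bot_eq_zero, Finsupp.coe_zero,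
          Pi.zero_apply] at this ⊢
        omega
      rw [h1, h2]
      exact ⟨_, hL.coprime_mem j j'⟩
    · exact hS j j' hjj hd
  refine ⟨ε, ?_⟩
  have := monomial_mul_mem_lowSpan n hε
  rw [← map_add] at this
  rwa [mul_sub, mul_smul_comm, ← mul_assoc, ← mul_assoc, monomial_mul, monomial_mul, one_mul,
    add_comm n, add_comm n (L j - L j'), add_comm n, add_right_comm] at this

/-- Descent on the weight bound. Among the multiples of top weight, one representative per leading
exponent suffices modulo lower ones. Its leading monomial occurs in no other representative, so
vanishing of that coefficient in `p` forces vanishing of the coefficient of the representative.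
Distinct monomials may have equal weight; no tie-breaking is needed because leading terms dominate
strictly. -/
theorem eq_zero_of_mem_lowSpan (hL : IsLead w f L u) (hS : OverlapsResolve w f L) (N : ℕ)
    {p : MvPolynomial σ K} (hp : p ∈ lowSpan w f L N)
    (hstd : ∀ m j, coeff (m + L j) p = 0) : p = 0 := by
  classical
  induction N with
  | zero =>
    have := hL.lowSpan_le 0 hp
    simpa [lowWeight, mem_restrictSupport_iff] using this
  | succ N ih =>
    apply ih
    let T := {M : σ →₀ ℕ | Finsupp.weight w M = N ∧ ∃ m j, M = m + L j}
    let rep : (σ →₀ ℕ) → MvPolynomial σ K := fun M =>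
      if h : M ∈ T then monomial (h.2.choose) 1 * f h.2.choose_spec.choose else 0
    have hrep : ∀ M ∈ T, ∃ m j, M = m + L j ∧ rep M = monomial m 1 * f j := fun M h =>
      ⟨h.2.choose, h.2.choose_spec.choose, h.2.choose_spec.choose_spec, dif_pos h⟩
    have hle : lowSpan w f L (N + 1) ≤ lowSpan w f L N ⊔ Submodule.span K (rep '' T) := by
      refine Submodule.span_le.2 ?_
      rintro _ ⟨m, j, hm, rfl⟩
      rcases Nat.lt_succ_iff_lt_or_eq.1 hm with h | h
      · exact Submodule.mem_sup_left (Submodule.subset_span ⟨m, j, h, rfl⟩)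
      · have hT : m + L j ∈ T := ⟨h, m, j, rfl⟩
        obtain ⟨m', j', he, hr⟩ := hrep _ hT
        obtain ⟨ε, hε⟩ := exists_sub_smul_mem_lowSpan hL hS he
        rw [h, ← hr] at hε
        have h2 : ε • rep (m + L j) ∈ Submodule.span K (rep '' T) :=
          Submodule.smul_mem _ _ (Submodule.subset_span ⟨_, hT, rfl⟩)
        simpa using add_mem (Submodule.mem_sup_left hε) (Submodule.mem_sup_right h2)
    obtain ⟨p', hp', g, hg, rfl⟩ := Submodule.mem_sup.1 (hle hp)
    obtain ⟨c, hc, rfl⟩ := (Finsupp.mem_span_image_iff_linearCombination K).1 hg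
    have hcoeff : ∀ M ∈ T, ∀ M' ∈ T, M ≠ M' → coeff M (rep M') = 0 := by
      intro M hM M' hM' hne
      obtain ⟨m, j, rfl, hr⟩ := hrep M' hM'
      have h1 := hL.monomial_mul_sub_mem m j
      rw [← hr, hM'.1, lowWeight, mem_restrictSupport_iff] at h1
      by_contra h0
      have : M ∈ (rep (m + L j) - monomial (m + L j) (u j)).support := by
        rw [mem_support_iff, coeff_sub, coeff_monomial, if_neg (Ne.symm hne), sub_zero]
        exact h0
      exact (h1 this).ne hM.1
    have hcoeff' : ∀ M ∈ T, coeff M (rep M) ≠ 0 := by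
      intro M hM h0
      obtain ⟨m, j, rfl, hr⟩ := hrep M hM
      have h1 := hL.monomial_mul_sub_mem m j
      rw [← hr, hM.1, lowWeight, mem_restrictSupport_iff] at h1
      have : m + L j ∈ (rep (m + L j) - monomial (m + L j) (u j)).support := by
        rw [mem_support_iff, coeff_sub, coeff_monomial, if_pos rfl, h0, zero_sub]
        exact neg_ne_zero.2 (hL j).1
      exact (h1 this).ne hM.1
    have hc0 : c = 0 := by
      ext M
      by_contra hM
      have hMT : M ∈ T := hc (Finsupp.mem_support_iff.2 hM)
      obtain ⟨m, j, he, -⟩ := hrep M hMT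
      have h0 := hstd m j
      rw [← he, coeff_add, Finsupp.linearCombination_apply, Finsupp.sum, coeff_sum] at h0
      have h1 : coeff M p' = 0 := by
        by_contra h
        exact (hL.lowSpan_le N hp' (mem_support_iff.2 h)).ne hMT.1
      rw [h1, zero_add, Finset.sum_eq_single M] at h0
      · rw [coeff_smul, smul_eq_mul] at h0
        exact (mul_ne_zero hM (hcoeff' M hMT)) h0
      · intro M' hM' hne
        rw [coeff_smul, hcoeff M hMT M' (hc hM') hne.symm, smul_zero]
      · intro h
        rw [Finsupp.notMem_support_iff.1 h, zero_smul, coeff_zero]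
    rw [hc0, map_zero, add_zero]
    exact hp'

theorem exists_mem_lowSpan_of_mem_span {p : MvPolynomial σ K} (hp : p ∈ Ideal.span (Set.range f)) :
    ∃ N, p ∈ lowSpan w f L N := by
  induction hp using Submodule.span_induction with
  | mem x hx =>
    obtain ⟨j, rfl⟩ := hx
    exact ⟨_, Submodule.subset_span ⟨0, j, Nat.lt_succ_self _, by simp [← C_apply]⟩⟩
  | zero => exact ⟨0, zero_mem _⟩
  | add x y _ _ hx hy =>
    obtain ⟨N, hx⟩ := hx
    obtain ⟨N', hy⟩ := hy
    exact ⟨max N N', add_mem (lowSpan_mono (le_max_left _ _) hx)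
      (lowSpan_mono (le_max_right _ _) hy)⟩
  | smul a x _ hx =>
    obtain ⟨N, hx⟩ := hx
    induction a using MvPolynomial.induction_on' with
    | monomial m c =>
      refine ⟨Finsupp.weight w m + N, ?_⟩
      have := Submodule.smul_mem _ c (monomial_mul_mem_lowSpan m hx)
      rwa [← smul_mul_assoc, smul_monomial, smul_eq_mul, mul_one] at this
    | add p q hp hq =>
      obtain ⟨N, hp⟩ := hp
      obtain ⟨N', hq⟩ := hq
      refine ⟨max N N', ?_⟩
      rw [add_smul]
      exact add_mem (lowSpan_mono (le_max_left _ _) hp) (lowSpan_mono (le_max_right _ _) hq)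

/-- Buchberger's criterion: if the overlaps resolve, then the leading monomials generate the ideal
of leading monomials, in the form that no standard polynomial lies in the ideal. -/
theorem eq_zero_of_mem_span (hL : IsLead w f L u) (hS : OverlapsResolve w f L)
    {p : MvPolynomial σ K} (hp : p ∈ Ideal.span (Set.range f))
    (hstd : ∀ m j, coeff (m + L j) p = 0) : p = 0 :=
  let ⟨N, hN⟩ := exists_mem_lowSpan_of_mem_span hp
  eq_zero_of_mem_lowSpan hL hS N hN hstd

/-- The exponents of degree `n` that are not divisible by a leading exponent. -/
def stdExp (L : J → σ →₀ ℕ) (n : ℕ) : Set (σ →₀ ℕ) := {m | m.degree = n ∧ ∀ j, ¬ L j ≤ m}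

/-- Reduction to standard monomials of the same degree. -/
theorem exists_std_sub_mem_span (hL : IsLead w f L u) {d : ℕ} (hf : ∀ j, (f j).IsHomogeneous d)
    {n : ℕ} {p : MvPolynomial σ K} (hp : p.IsHomogeneous n) :
    ∃ s ∈ restrictSupport K (stdExp L n), p - s ∈ Ideal.span (Set.range f) := by
  classical
  suffices h : ∀ N (m : σ →₀ ℕ), Finsupp.weight w m < N → m.degree = n →
      ∃ s ∈ restrictSupport K (stdExp L n), monomial m 1 - s ∈ Ideal.span (Set.range f) by
    let S : Submodule K (MvPolynomial σ K) := restrictSupport K (stdExp L n) ⊔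
      (Ideal.span (Set.range f)).restrictScalars K
    have hpS : p ∈ S := by
      rw [p.as_sum]
      refine sum_mem fun m hm => ?_
      obtain ⟨s, hs, hs'⟩ := h _ m (Nat.lt_succ_self _)
        (by rw [Finsupp.degree_eq_weight_one]; exact hp (mem_support_iff.1 hm))
      have : monomial m (coeff m p) = coeff m p • (s + (monomial m 1 - s)) := by
        simp [smul_monomial]
      rw [this]
      exact Submodule.smul_mem _ _
        (add_mem (Submodule.mem_sup_left hs) (Submodule.mem_sup_right hs'))
    obtain ⟨s, hs, g, hg, rfl⟩ := Submodule.mem_sup.1 hpS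
    exact ⟨s, hs, by simpa using hg⟩
  intro N
  induction N with
  | zero => intro m hm; omega
  | succ N ih =>
    intro m hm hdeg
    by_cases hstd : ∀ j, ¬ L j ≤ m
    · exact ⟨monomial m 1, (monomial_mem_restrictSupport K).2 (Or.inl ⟨hdeg, hstd⟩), by rw [sub_self]; exact zero_mem _⟩
    push Not at hstd
    obtain ⟨j, hj⟩ := hstd
    obtain ⟨m', rfl⟩ := exists_add_of_le hj
    rw [add_comm] at hm hdeg ⊢
    let S : Submodule K (MvPolynomial σ K) := restrictSupport K (stdExp L n) ⊔
      (Ideal.span (Set.range f)).restrictScalars K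
    have hu := (hL j).1
    have hlow := hL.monomial_mul_sub_mem m' j
    -- The leading monomial really occurs in `f j`. This makes the tail of the multiple homogeneous
    -- of degree `n`, so that reduction preserves the degree.
    have hd : d = (L j).degree := by
      have hc : coeff (L j) (f j) ≠ 0 := by
        intro h0
        have : L j ∈ (f j - monomial (L j) (u j)).support := by
          rw [mem_support_iff, coeff_sub, coeff_monomial, if_pos rfl, h0, zero_sub]
          exact neg_ne_zero.2 hu
        have hlt : Finsupp.weight w (L j) < Finsupp.weight w (L j) := (hL j).2 this
        exact lt_irrefl _ hlt
      rw [Finsupp.degree_eq_weight_one]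
      exact (hf j hc).symm
    have hhom : (monomial m' 1 * f j - monomial (m' + L j) (u j)).IsHomogeneous n := by
      refine IsHomogeneous.sub ?_ (isHomogeneous_monomial _ hdeg)
      rw [← hdeg, map_add, ← hd]
      exact (isHomogeneous_monomial _ rfl).mul (hf j)
    have hS : monomial m' 1 * f j - monomial (m' + L j) (u j) ∈ S := by
      set q := monomial m' 1 * f j - monomial (m' + L j) (u j)
      rw [q.as_sum]
      refine sum_mem fun m hm2 => ?_
      obtain ⟨s, hs, hs'⟩ := ih m (lt_of_lt_of_le (show _ < _ from hlow hm2) (Nat.lt_succ_iff.1 hm))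
        (by rw [Finsupp.degree_eq_weight_one]; exact hhom (mem_support_iff.1 hm2))
      have : monomial m (coeff m q) = coeff m q • (s + (monomial m 1 - s)) := by
        simp [smul_monomial]
      rw [this]
      exact Submodule.smul_mem _ _
        (add_mem (Submodule.mem_sup_left hs) (Submodule.mem_sup_right hs'))
    have hf' : monomial m' 1 * f j ∈ S :=
      Submodule.mem_sup_right (Ideal.mul_mem_left _ _ (Ideal.subset_span ⟨j, rfl⟩))
    have hmem : monomial (m' + L j) (1 : K) ∈ S := by
      have := Submodule.smul_mem _ (u j)⁻¹ (sub_mem hf' hS)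
      rwa [sub_sub_cancel, smul_monomial, smul_eq_mul, inv_mul_cancel₀ hu] at this
    obtain ⟨s, hs, g, hg, he⟩ := Submodule.mem_sup.1 hmem
    exact ⟨s, hs, by rw [← he]; simpa using hg⟩

end Groebner

/-! ### The affine weights as a strip in the plane lattice -/

open Weight

deriving instance DecidableEq for Weight

/-- The list of all weights. -/
def allWeights : List Weight :=
  [o, w12, w13, w14, w15, w23, w24, w25, w34, w35, w45, p1, p2, p3, p4, p5]

theorem mem_allWeights (α : Weight) : α ∈ allWeights := by cases α <;> decide

/-- The first coordinate in an embedding of the weights of level zero into a plane lattice. -/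
def Weight.cx : Weight → ℤ
  | o => 0 | w12 => 0 | w13 => 0 | w23 => 0 | w14 => 1 | w24 => 1 | w34 => 1 | p5 => 1
  | w15 => 2 | w25 => 2 | w35 => 2 | p4 => 2 | w45 => 3 | p3 => 3 | p2 => 3 | p1 => 3

/-- The second coordinate in an embedding of the weights of level zero into a plane lattice. -/
def Weight.cy : Weight → ℤ
  | o => 0 | w12 => 1 | w13 => 2 | w23 => 3 | w14 => 2 | w24 => 3 | w34 => 4 | p5 => 5
  | w15 => 2 | w25 => 3 | w35 => 4 | p4 => 5 | w45 => 4 | p3 => 5 | p2 => 6 | p1 => 7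

/-- The first plane coordinate of an affine weight. -/
def AffWeight.cx (x : AffWeight) : ℤ := 4 * x.lev + x.wt.cx

/-- The second plane coordinate of an affine weight. -/
def AffWeight.cy (x : AffWeight) : ℤ := 4 * x.lev + x.wt.cy

theorem AffWeight.ht_eq (x : AffWeight) : x.ht = x.cx + x.cy := by
  obtain ⟨α, l⟩ := x
  cases α <;> simp [AffWeight.ht, AffWeight.cx, AffWeight.cy, Weight.ht, Weight.cx, Weight.cy] <;>
    ring

theorem Weight.ext_coord {α β : Weight} (hx : α.cx = β.cx) (hy : α.cy = β.cy) : α = β := by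
  have h : ∀ α ∈ allWeights, ∀ β ∈ allWeights, α.cx = β.cx → α.cy = β.cy → α = β := by decide
  exact h α (mem_allWeights α) β (mem_allWeights β) hx hy

theorem AffWeight.ext_coord {x y : AffWeight} (hx : x.cx = y.cx) (hy : x.cy = y.cy) : x = y := by
  have h : ∀ α : Weight, 0 ≤ α.cx ∧ α.cx ≤ 3 := by intro α; cases α <;> decide
  have h1 := h x.wt
  have h2 := h y.wt
  simp only [AffWeight.cx, AffWeight.cy] at hx hy
  have hl : x.lev = y.lev := by omega
  exact AffWeight.ext (Weight.ext_coord (by omega) (by omega)) hl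

/-- Each column of the picture has four consecutive points, and the columns rise by two at every
second step. These inequalities are what lets linear arithmetic decide order questions later. -/
theorem AffWeight.strip (x : AffWeight) :
    2 * ((x.cx + 1) / 2) ≤ x.cy ∧ x.cy ≤ 2 * ((x.cx + 1) / 2) + 3 := by
  obtain ⟨α, l⟩ := x
  cases α <;> simp only [AffWeight.cx, AffWeight.cy, Weight.cx, Weight.cy] <;> omega

theorem Arrow.coord_le {x y : AffWeight} (h : Arrow x y) : x.cx ≤ y.cx ∧ x.cy ≤ y.cy := by
  cases h <;> simp only [AffWeight.cx, AffWeight.cy, Weight.cx, Weight.cy] <;> omega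

/-- Arrows are unit steps to the right or upwards. Where only one arrow leaves `x`, the other step
would leave the strip, and `y` cannot lie purely in that direction. -/
theorem exists_arrow {x y : AffWeight} (hx : x.cx ≤ y.cx) (hy : x.cy ≤ y.cy) (hne : x ≠ y) :
    ∃ z, Arrow x z ∧ z.cx ≤ y.cx ∧ z.cy ≤ y.cy := by
  have hs := y.strip
  have hc : ¬ (x.cx = y.cx ∧ x.cy = y.cy) := fun h => hne (AffWeight.ext_coord h.1 h.2)
  have pick1 : ∀ z, Arrow x z → (z.cx ≤ y.cx ∧ z.cy ≤ y.cy) →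
      ∃ z, Arrow x z ∧ z.cx ≤ y.cx ∧ z.cy ≤ y.cy := fun z h h' => ⟨z, h, h'⟩
  have pick2 : ∀ z z', Arrow x z → Arrow x z' → (z.cx ≤ y.cx ∧ z.cy ≤ y.cy ∨
      z'.cx ≤ y.cx ∧ z'.cy ≤ y.cy) → ∃ z, Arrow x z ∧ z.cx ≤ y.cx ∧ z.cy ≤ y.cy :=
    fun z z' h h' hor => hor.elim (fun hh => ⟨z, h, hh⟩) (fun hh => ⟨z', h', hh⟩)
  generalize y.cx = a at *
  generalize y.cy = b at *
  obtain ⟨α, r⟩ := x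
  cases α
  case' o => refine pick1 _ (.a01 r) ?_
  case' w12 => refine pick1 _ (.a02 r) ?_
  case' w13 => refine pick2 _ _ (.a03 r) (.a04 r) ?_
  case' w14 => refine pick2 _ _ (.a06 r) (.a07 r) ?_
  case' w15 => refine pick1 _ (.a10 r) ?_
  case' w23 => refine pick1 _ (.a05 r) ?_
  case' w24 => refine pick2 _ _ (.a08 r) (.a09 r) ?_
  case' w25 => refine pick1 _ (.a13 r) ?_
  case' w34 => refine pick2 _ _ (.a11 r) (.a12 r) ?_
  case' w35 => refine pick2 _ _ (.a15 r) (.a16 r) ?_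
  case' w45 => refine pick2 _ _ (.a18 r) (.b1 r) ?_
  case' p1 => refine pick1 _ (.b4 r) ?_
  case' p2 => refine pick2 _ _ (.a20 r) (.b3 r) ?_
  case' p3 => refine pick2 _ _ (.a19 r) (.b2 r) ?_
  case' p4 => refine pick1 _ (.a17 r) ?_
  case' p5 => refine pick1 _ (.a14 r) ?_
  all_goals
    simp only [AffWeight.cx, AffWeight.cy, Weight.cx, Weight.cy] at *
    omega

/-- The order of the affine weights is the product order of the plane. -/
theorem AffWeight.le_iff {x y : AffWeight} : x ≤ y ↔ x.cx ≤ y.cx ∧ x.cy ≤ y.cy := by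
  constructor
  · intro (h : Relation.ReflTransGen Arrow x y)
    induction h with
    | refl => exact ⟨le_rfl, le_rfl⟩
    | tail _ h ih => exact ⟨ih.1.trans h.coord_le.1, ih.2.trans h.coord_le.2⟩
  · intro h
    obtain ⟨n, hn⟩ : ∃ n : ℕ, y.ht - x.ht ≤ n := ⟨_, Int.self_le_toNat _⟩
    induction n generalizing x with
    | zero =>
      rw [AffWeight.ht_eq, AffWeight.ht_eq] at hn
      exact (AffWeight.ext_coord (by omega) (by omega) : x = y).le
    | succ n ih =>
      by_cases hne : x = y
      · exact hne.le
      obtain ⟨z, hz, hzy⟩ := exists_arrow h.1 h.2 hne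
      have h1 : x ≤ z := Relation.ReflTransGen.single hz
      exact h1.trans (ih hzy (by have := hz.ht_succ; omega))

theorem AffWeight.ht_lt_of_lt {x y : AffWeight} (h : x < y) : x.ht < y.ht :=
  (eq_or_ht_lt h.le).resolve_left h.ne

/-! ### Leading monomials and incomparable pairs -/

/-- The position of the leading term in the list of the terms of a quadric; it depends on the
parity of the exponent of the series variable. -/
def leadPos : Fin 5 ⊕ Fin 5 → ℤ → ℕ
  | .inl _, k => if k % 2 = 0 then 1 else 0
  | .inr _, k => if k % 2 = 0 then 3 else 0

/-- The term of a quadric that contains the leading monomial. -/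
def leadTerm (s : Fin 5 ⊕ Fin 5) (k : ℤ) : ℤ × Weight × Weight :=
  (quadric s).getD (leadPos s k) (0, o, o)

/-- The first factor of the leading monomial of a relation. -/
def leadFst (s : Fin 5 ⊕ Fin 5) (k : ℤ) : AffWeight :=
  ⟨(leadTerm s k).2.1, if s.isLeft then (k + 1) / 2 else k / 2⟩

/-- The second factor of the leading monomial of a relation. -/
def leadSnd (s : Fin 5 ⊕ Fin 5) (k : ℤ) : AffWeight :=
  ⟨(leadTerm s k).2.2, k - (leadFst s k).lev⟩

/-- The two factors of the leading monomial of a relation. -/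
def leadEnd (s : Fin 5 ⊕ Fin 5) (k : ℤ) : Bool → AffWeight
  | false => leadFst s k
  | true => leadSnd s k

/-- The pair `x`, `y` encloses `A` and `B`. -/
def Straddle (A B x y : AffWeight) : Prop := (x ≤ A ∧ x ≤ B) ∧ A ≤ y ∧ B ≤ y

deriving instance DecidableEq for AffWeight

theorem leadTerm_add_two_mul (s : Fin 5 ⊕ Fin 5) (k m : ℤ) :
    leadTerm s (k + 2 * m) = leadTerm s k := by
  unfold leadTerm
  congr 1
  rcases s with s | s <;> simp [leadPos]

theorem leadEnd_add_two_mul (s : Fin 5 ⊕ Fin 5) (k m : ℤ) (e : Bool) :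
    leadEnd s (k + 2 * m) e = ⟨(leadEnd s k e).wt, (leadEnd s k e).lev + m⟩ := by
  rcases s with s | s <;> cases e <;>
    simp [leadEnd, leadFst, leadSnd, leadTerm_add_two_mul] <;> omega

theorem incomparable_lead (s : Fin 5 ⊕ Fin 5) (k : ℤ) :
    ¬ leadFst s k ≤ leadSnd s k ∧ ¬ leadSnd s k ≤ leadFst s k := by
  simp only [AffWeight.le_iff]
  rcases Int.emod_two_eq_zero_or_one k with h | h <;> rcases s with s | s <;> fin_cases s <;>
    simp [leadFst, leadSnd, leadTerm, leadPos, h, quadric, AffWeight.cx, AffWeight.cy, Weight.cx,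
      Weight.cy] <;> omega

/-- `Straddle` in terms of plane coordinates. -/
def StraddleCoord (A B x y : AffWeight) : Prop :=
  ((x.cx ≤ A.cx ∧ x.cy ≤ A.cy) ∧ x.cx ≤ B.cx ∧ x.cy ≤ B.cy) ∧
    (A.cx ≤ y.cx ∧ A.cy ≤ y.cy) ∧ B.cx ≤ y.cx ∧ B.cy ≤ y.cy

instance (A B x y : AffWeight) : Decidable (StraddleCoord A B x y) := by
  unfold StraddleCoord
  infer_instance

theorem straddle_iff {A B x y : AffWeight} : Straddle A B x y ↔ StraddleCoord A B x y := by
  simp only [Straddle, StraddleCoord, AffWeight.le_iff]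

theorem Weight.coord_bounds (α : Weight) : (0 ≤ α.cx ∧ α.cx ≤ 3) ∧ 0 ≤ α.cy ∧ α.cy ≤ 7 := by
  cases α <;> decide

theorem straddle_add {A B x y : AffWeight} (m : ℤ) (h : Straddle A B x y) :
    Straddle ⟨A.wt, A.lev + m⟩ ⟨B.wt, B.lev + m⟩ ⟨x.wt, x.lev + m⟩ ⟨y.wt, y.lev + m⟩ := by
  simp only [straddle_iff, StraddleCoord, AffWeight.cx, AffWeight.cy] at h ⊢
  omega

/-- Level-zero coordinates lie between 0 and 7 and a level adds 4 to each, so these levels clear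
both `A` and `B`. This leaves only finitely many indices to check in `exists_lead_term`. -/
theorem straddle_of_lev_le {A B : AffWeight} {a b : ℤ} (α β : Weight)
    (hA : 0 ≤ A.lev ∧ A.lev ≤ 1) (hB : 0 ≤ B.lev ∧ B.lev ≤ 1) (ha : a ≤ -2) (hb : 3 ≤ b) :
    Straddle A B ⟨α, a⟩ ⟨β, b⟩ := by
  have := A.wt.coord_bounds
  have := B.wt.coord_bounds
  have := α.coord_bounds
  have := β.coord_bounds
  simp only [straddle_iff, StraddleCoord, AffWeight.cx, AffWeight.cy]
  omega

/-- `StraddleAt s k m a`: the product with index `a` in the term `m` of the quadric `s` encloses the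
leading monomial. -/
def StraddleAt (s : Fin 5 ⊕ Fin 5) (k : ℤ) (m : ℤ × Weight × Weight) (a : ℤ) : Prop :=
  Straddle (leadFst s k) (leadSnd s k) ⟨m.2.1, a⟩ ⟨m.2.2, k - a⟩ ∨
    Straddle (leadFst s k) (leadSnd s k) ⟨m.2.2, k - a⟩ ⟨m.2.1, a⟩

theorem leadFst_add_two_mul (s : Fin 5 ⊕ Fin 5) (k m : ℤ) :
    leadFst s (k + 2 * m) = ⟨(leadFst s k).wt, (leadFst s k).lev + m⟩ :=
  leadEnd_add_two_mul s k m false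

theorem leadSnd_add_two_mul (s : Fin 5 ⊕ Fin 5) (k m : ℤ) :
    leadSnd s (k + 2 * m) = ⟨(leadSnd s k).wt, (leadSnd s k).lev + m⟩ :=
  leadEnd_add_two_mul s k m true

theorem StraddleAt.add {s : Fin 5 ⊕ Fin 5} {k : ℤ} {t : ℤ × Weight × Weight} {a : ℤ} (m : ℤ)
    (h : StraddleAt s k t a) : StraddleAt s (k + 2 * m) t (a + m) := by
  rw [StraddleAt, leadFst_add_two_mul, leadSnd_add_two_mul, show k + 2 * m - (a + m) = k - a + m by ring]
  exact h.imp (straddle_add m) (straddle_add m)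

theorem exists_eq_add_two_mul (k : ℤ) : ∃ i ∈ [(0 : ℤ), 1], ∃ m, k = i + 2 * m :=
  ⟨k % 2, by rcases Int.emod_two_eq_zero_or_one k with h | h <;> simp [h], k / 2, by omega⟩

/-- Only the leading term of a relation is a product of incomparable generators. -/
theorem exists_lead_term (s : Fin 5 ⊕ Fin 5) (k : ℤ) : ∃ l₁ l₂,
    quadric s = l₁ ++ leadTerm s k :: l₂ ∧
      (∀ a, a ≠ (leadFst s k).lev → StraddleAt s k (leadTerm s k) a) ∧
      ∀ m ∈ l₁ ++ l₂, ∀ a, StraddleAt s k m a := by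
  obtain ⟨i, hi, n, rfl⟩ := exists_eq_add_two_mul k
  rw [leadTerm_add_two_mul, leadFst_add_two_mul]
  -- Shifting all levels by `n` changes the exponent by `2 * n`, so only exponents 0 and 1 matter.
  -- Indices outside this window are far enough apart to enclose the leading pair.
  have check : ∀ s, ∀ i ∈ [(0 : ℤ), 1],
      (quadric s = (quadric s).take (leadPos s i) ++
        leadTerm s i :: (quadric s).drop (leadPos s i + 1)) ∧
      ((0 ≤ (leadFst s i).lev ∧ (leadFst s i).lev ≤ 1) ∧
        (0 ≤ (leadSnd s i).lev ∧ (leadSnd s i).lev ≤ 1)) ∧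
      ∀ m ∈ quadric s, ∀ a ∈ [(-2 : ℤ), -1, 0, 1, 2, 3],
        (m = leadTerm s i ∧ a = (leadFst s i).lev) ∨
        StraddleCoord (leadFst s i) (leadSnd s i) ⟨m.2.1, a⟩ ⟨m.2.2, i - a⟩ ∨
        StraddleCoord (leadFst s i) (leadSnd s i) ⟨m.2.2, i - a⟩ ⟨m.2.1, a⟩ := by
    decide +kernel
  have hnodup : ∀ s, (quadric s).Nodup := by decide
  obtain ⟨h1, ⟨hA, hB⟩, h2⟩ := check s i hi
  have hi' : i = 0 ∨ i = 1 := by simpa using hi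
  have h3 : ∀ m ∈ quadric s, ∀ a, (m = leadTerm s i ∧ a = (leadFst s i).lev) ∨
      StraddleAt s i m a := by
    intro m hm a
    rcases le_or_gt a (-3) with ha | ha
    · exact Or.inr (Or.inl (straddle_of_lev_le _ _ hA hB (by omega) (by omega)))
    rcases le_or_gt a 3 with ha' | ha'
    · have := h2 m hm a (by simp only [List.mem_cons, List.not_mem_nil]; omega)
      simpa only [StraddleAt, straddle_iff] using this
    · exact Or.inr (Or.inr (straddle_of_lev_le _ _ hA hB (by omega) (by omega)))
  refine ⟨_, _, h1, fun a ha => ?_, fun m hm a => ?_⟩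
  · have := h3 (leadTerm s i) (by rw [h1]; simp) (a - n)
    rw [← sub_add_cancel a n]
    exact (this.resolve_left fun h => ha (by simp only [← h.2]; ring)).add n
  · have hm' : m ∈ quadric s := by rw [h1]; simp only [List.mem_append, List.mem_cons] at hm ⊢; tauto
    have hne : m ≠ leadTerm s i := by
      rintro rfl
      have hd := hnodup s
      rw [h1, List.nodup_middle, List.nodup_cons] at hd
      exact hd.1 hm
    have := h3 m hm' (a - n)
    rw [← sub_add_cancel a n]
    exact (this.resolve_left fun h => hne h.1).add n

/-- The height of a quadric of level zero. -/
def quadricHt (s : Fin 5 ⊕ Fin 5) : ℤ :=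
  (leadTerm s 0).2.1.ht + (leadTerm s 0).2.2.ht

theorem ht_add_ht (s : Fin 5 ⊕ Fin 5) (k a : ℤ) : ∀ m ∈ quadric s,
    AffWeight.ht ⟨m.2.1, a⟩ + AffWeight.ht ⟨m.2.2, k - a⟩ = 8 * k + quadricHt s := by
  have h : ∀ s, ∀ m ∈ quadric s, m.2.1.ht + m.2.2.ht = quadricHt s := by decide
  intro m hm
  rw [← h s m hm, AffWeight.ht, AffWeight.ht]
  ring

theorem leadTerm_mem (s : Fin 5 ⊕ Fin 5) (k : ℤ) : leadTerm s k ∈ quadric s := by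
  obtain ⟨l₁, l₂, h, -⟩ := exists_lead_term s k
  rw [h]
  simp

theorem ht_lead (s : Fin 5 ⊕ Fin 5) (k : ℤ) :
    (leadFst s k).ht + (leadSnd s k).ht = 8 * k + quadricHt s :=
  ht_add_ht s k _ _ (leadTerm_mem s k)

/-- For pairs of equal sum the squares differ by `2 * (A.ht - x.ht) * (B.ht - x.ht)`, where `A`, `B`
is the leading pair. Both factors are positive: if `x` were equal to `A` or `B`, these would be
comparable. -/
theorem Straddle.sq_lt {s : Fin 5 ⊕ Fin 5} {k : ℤ} {x y : AffWeight}
    (h : Straddle (leadFst s k) (leadSnd s k) x y)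
    (hs : x.ht + y.ht = (leadFst s k).ht + (leadSnd s k).ht) :
    (leadFst s k).ht ^ 2 + (leadSnd s k).ht ^ 2 < x.ht ^ 2 + y.ht ^ 2 := by
  obtain ⟨⟨hA, hB⟩, -, -⟩ := h
  obtain ⟨i1, i2⟩ := incomparable_lead s k
  have h1 : x.ht < (leadFst s k).ht := AffWeight.ht_lt_of_lt (lt_of_le_of_ne hA (by
    intro he; exact i1 (he ▸ hB)))
  have h2 : x.ht < (leadSnd s k).ht := AffWeight.ht_lt_of_lt (lt_of_le_of_ne hB (by
    intro he; exact i2 (he ▸ hA)))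
  have : y.ht = (leadFst s k).ht + (leadSnd s k).ht - x.ht := by omega
  rw [this]
  nlinarith [mul_pos (sub_pos.2 h1) (sub_pos.2 h2)]

/-- Incomparable affine weights form the leading monomial of some relation. -/
theorem exists_lead_eq {x y : AffWeight} (hxy : ¬ x ≤ y) (hyx : ¬ y ≤ x) :
    ∃ s k, (leadFst s k = x ∧ leadSnd s k = y) ∨ (leadFst s k = y ∧ leadSnd s k = x) := by
  suffices h : ∀ x y : AffWeight, x.cx < y.cx → y.cy < x.cy →
      ∃ s k, (leadFst s k = x ∧ leadSnd s k = y) ∨ (leadFst s k = y ∧ leadSnd s k = x) by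
    simp only [AffWeight.le_iff] at hxy hyx
    rcases lt_trichotomy x.cx y.cx with hc | hc | hc
    · exact h x y hc (by omega)
    · omega
    · obtain ⟨s, k, hh⟩ := h y x hc (by omega)
      exact ⟨s, k, hh.symm⟩
  rintro ⟨α, a⟩ ⟨β, b⟩ hx hy
  -- The strip is too narrow for incomparable elements whose levels differ by more than one.
  have hb : b = a ∨ b = a + 1 := by
    cases α <;> cases β <;> simp only [AffWeight.cx, AffWeight.cy, Weight.cx, Weight.cy] at hx hy <;>
      omega
  have check : ∀ α ∈ allWeights, ∀ β ∈ allWeights, ∀ i ∈ [(0 : ℤ), 1],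
      α.cx < 4 * i + β.cx → 4 * i + β.cy < α.cy → ∃ s,
      (leadFst s i = ⟨α, 0⟩ ∧ leadSnd s i = ⟨β, i⟩) ∨
        (leadFst s i = ⟨β, i⟩ ∧ leadSnd s i = ⟨α, 0⟩) := by
    decide +kernel
  obtain ⟨i, hi, rfl⟩ : ∃ i ∈ [(0 : ℤ), 1], b = i + a := by
    rcases hb with rfl | rfl
    · exact ⟨0, by simp, by ring⟩
    · exact ⟨1, by simp, by ring⟩
  simp only [AffWeight.cx, AffWeight.cy] at hx hy
  obtain ⟨s, hs⟩ := check α (mem_allWeights α) β (mem_allWeights β) i hi (by omega) (by omega)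
  refine ⟨s, i + 2 * a, ?_⟩
  rw [leadFst_add_two_mul, leadSnd_add_two_mul]
  rcases hs with ⟨h1, h2⟩ | ⟨h1, h2⟩
  · left; simp [h1, h2]
  · right; simp [h1, h2]

/-! ### Linear syzygies and the overlaps of leading monomials -/

/-- The sixteen linear syzygies of the ten quadrics, as lists of terms `c * λ^β * quadric s`. -/
def syzygy : Fin 16 → Fin 5 → ℤ × Weight × (Fin 5 ⊕ Fin 5) := ![
  ![(-1, o, .inr 0), (1, w12, .inl 1), (1, w13, .inl 2), (1, w14, .inl 3), (1, w15, .inl 4)],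
  ![(-1, o, .inr 1), (-1, w12, .inl 0), (1, w23, .inl 2), (1, w24, .inl 3), (1, w25, .inl 4)],
  ![(-1, o, .inr 2), (-1, w13, .inl 0), (-1, w23, .inl 1), (1, w34, .inl 3), (1, w35, .inl 4)],
  ![(-1, o, .inr 3), (-1, w14, .inl 0), (-1, w24, .inl 1), (-1, w34, .inl 2), (1, w45, .inl 4)],
  ![(1, o, .inr 4), (1, w15, .inl 0), (1, w25, .inl 1), (1, w35, .inl 2), (1, w45, .inl 3)],
  ![(1, w12, .inr 2), (-1, w13, .inr 1), (1, w23, .inr 0), (1, p4, .inl 4), (1, p5, .inl 3)],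
  ![(-1, w12, .inr 3), (1, w14, .inr 1), (-1, w24, .inr 0), (-1, p3, .inl 4), (1, p5, .inl 2)],
  ![(-1, w12, .inr 4), (1, w15, .inr 1), (-1, w25, .inr 0), (1, p3, .inl 3), (1, p4, .inl 2)],
  ![(1, w13, .inr 3), (-1, w14, .inr 2), (1, w34, .inr 0), (1, p2, .inl 4), (1, p5, .inl 1)],
  ![(1, w13, .inr 4), (-1, w15, .inr 2), (1, w35, .inr 0), (-1, p2, .inl 3), (1, p4, .inl 1)],
  ![(1, w14, .inr 4), (-1, w15, .inr 3), (1, w45, .inr 0), (1, p2, .inl 2), (1, p3, .inl 1)],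
  ![(-1, w23, .inr 3), (1, w24, .inr 2), (-1, w34, .inr 1), (-1, p1, .inl 4), (1, p5, .inl 0)],
  ![(-1, w23, .inr 4), (1, w25, .inr 2), (-1, w35, .inr 1), (1, p1, .inl 3), (1, p4, .inl 0)],
  ![(-1, w24, .inr 4), (1, w25, .inr 3), (-1, w45, .inr 1), (-1, p1, .inl 2), (1, p3, .inl 0)],
  ![(-1, w34, .inr 4), (1, w35, .inr 3), (-1, w45, .inr 2), (1, p1, .inl 1), (1, p2, .inl 0)],
  ![(1, p1, .inr 0), (-1, p2, .inr 1), (1, p3, .inr 2), (-1, p4, .inr 3), (1, p5, .inr 4)]]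

/-- The total height of a linear syzygy at level zero. -/
def syzygyHt (σ : Fin 16) : ℤ := (syzygy σ 0).2.1.ht + quadricHt (syzygy σ 0).2.2

/-- The height of the generator in the term of a syzygy with label `i` and level `a`. -/
def syzygyGen (σ : Fin 16) (i : Fin 5) (a : ℤ) : AffWeight := ⟨(syzygy σ i).2.1, a⟩

/-- The sum of the squares of the heights of the factors of the leading monomial in the term with
label `i` and level `a` of a syzygy. -/
def syzygySq (σ : Fin 16) (l : ℤ) (i : Fin 5) (a : ℤ) : ℤ :=
  (syzygyGen σ i a).ht ^ 2 + ((leadFst (syzygy σ i).2.2 (l - a)).ht ^ 2 +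
    (leadSnd (syzygy σ i).2.2 (l - a)).ht ^ 2)

theorem syzygyGen_ht_add (σ : Fin 16) (l : ℤ) (i : Fin 5) (a : ℤ) :
    (syzygyGen σ i a).ht + ((leadFst (syzygy σ i).2.2 (l - a)).ht +
      (leadSnd (syzygy σ i).2.2 (l - a)).ht) = 8 * l + syzygyHt σ := by
  have h : ∀ σ i, (syzygy σ i).2.1.ht + quadricHt (syzygy σ i).2.2 = syzygyHt σ := by decide +kernel
  rw [ht_lead, ← h σ i, syzygyGen, AffWeight.ht]
  ring

theorem ht_shift (x : AffWeight) (m : ℤ) : AffWeight.ht ⟨x.wt, x.lev + m⟩ = x.ht + 8 * m := by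
  simp only [AffWeight.ht]
  ring

/-- A cubic term has three factors, so raising each level by `m` raises `l` by `3 * m`. The total
height is the same for all terms, hence the added amount depends on neither `i` nor `a`, and
comparisons are invariant under the shift. -/
theorem syzygySq_shift (σ : Fin 16) (l : ℤ) (i : Fin 5) (a m : ℤ) :
    syzygySq σ (l + 3 * m) i (a + m) =
      syzygySq σ l i a + 16 * m * (8 * l + syzygyHt σ) + 192 * m ^ 2 := by
  rw [← syzygyGen_ht_add σ l i a]
  have h1 : (syzygyGen σ i (a + m)).ht = (syzygyGen σ i a).ht + 8 * m := ht_shift ⟨_, a⟩ m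
  rw [syzygySq, syzygySq, show l + 3 * m - (a + m) = l - a + 2 * m by ring, leadFst_add_two_mul,
    leadSnd_add_two_mul, ht_shift, ht_shift, h1]
  ring

/-- The two leading factors have fixed sum, so their squares are smallest when they are equal. The
bound grows with the level of the generator and leaves only a bounded window of levels. -/
theorem le_six_mul_syzygySq (σ : Fin 16) (l : ℤ) (i : Fin 5) (a : ℤ) :
    (3 * (syzygyGen σ i a).ht - (8 * l + syzygyHt σ)) ^ 2 + 2 * (8 * l + syzygyHt σ) ^ 2 ≤
      6 * syzygySq σ l i a := by
  rw [← syzygyGen_ht_add σ l i a, syzygySq]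
  nlinarith [sq_nonneg ((leadFst (syzygy σ i).2.2 (l - a)).ht -
    (leadSnd (syzygy σ i).2.2 (l - a)).ht)]

/-- Two overlapping leading monomials with product `a * b * c` are the leading monomials of two terms
of a linear syzygy, and these two dominate all other terms. -/
def Resolves (σ : Fin 16) (l : ℤ) (i i' : Fin 5) (s s' : Fin 5 ⊕ Fin 5) (k k' : ℤ)
    (a c : AffWeight) : Prop :=
  ((syzygy σ i).2 = (c.wt, s) ∧ (syzygy σ i').2 = (a.wt, s')) ∧
    (l = c.lev + k ∧ l = a.lev + k') ∧ i ≠ i' ∧ a ≠ c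

instance (σ : Fin 16) (l : ℤ) (i i' : Fin 5) (s s' : Fin 5 ⊕ Fin 5) (k k' : ℤ)
    (a c : AffWeight) : Decidable (Resolves σ l i i' s s' k k' a c) := by
  unfold Resolves
  infer_instance

/-- The finite core of the resolution of overlaps. The bound 60 is there for the levels outside
`[-4, 4]`: five levels change three times the height by 120, so the deviation stays at least 60
there, and `le_six_mul_syzygySq` puts `syzygySq` above its value at the leading terms. -/
theorem overlap_check : ∀ s, ∀ k ∈ [(0 : ℤ), 1], ∀ s', ∀ k' ∈ [(-1 : ℤ), 0, 1, 2, 3], ∀ e e',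
    leadEnd s k e = leadEnd s' k' e' → (s, k) ≠ (s', k') → ∃ σ i i',
      Resolves σ ((leadEnd s' k' !e').lev + k) i i' s s' k k' (leadEnd s k !e) (leadEnd s' k' !e') ∧
      (6 * syzygySq σ ((leadEnd s' k' !e').lev + k) i (leadEnd s' k' !e').lev <
          2 * (8 * ((leadEnd s' k' !e').lev + k) + syzygyHt σ) ^ 2 + 60 ^ 2) ∧
      ∀ j, ((-60) ≤ 3 * (syzygyGen σ j 0).ht - (8 * ((leadEnd s' k' !e').lev + k) + syzygyHt σ) ∧
          3 * (syzygyGen σ j 0).ht - (8 * ((leadEnd s' k' !e').lev + k) + syzygyHt σ) ≤ 60) ∧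
        ∀ b ∈ [(-4 : ℤ), -3, -2, -1, 0, 1, 2, 3, 4],
          (j = i ∧ b = (leadEnd s' k' !e').lev) ∨ (j = i' ∧ b = (leadEnd s k !e).lev) ∨
          syzygySq σ ((leadEnd s' k' !e').lev + k) i (leadEnd s' k' !e').lev <
            syzygySq σ ((leadEnd s' k' !e').lev + k) j b := by
  decide +kernel

theorem exists_resolves {s s' : Fin 5 ⊕ Fin 5} {k k' : ℤ} {e e' : Bool}
    (h : leadEnd s k e = leadEnd s' k' e') (hne : (s, k) ≠ (s', k')) :
    ∃ σ l i i', Resolves σ l i i' s s' k k' (leadEnd s k !e) (leadEnd s' k' !e') ∧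
      ∀ j b, (j = i ∧ b = (leadEnd s' k' !e').lev) ∨ (j = i' ∧ b = (leadEnd s k !e).lev) ∨
        syzygySq σ l i (leadEnd s' k' !e').lev < syzygySq σ l j b := by
  obtain ⟨n, hn, m, rfl⟩ := exists_eq_add_two_mul k
  obtain ⟨n', rfl⟩ : ∃ n', k' = n' + 2 * m := ⟨k' - 2 * m, by ring⟩
  -- Each factor has level within 1/2 of `k / 2`, so a common factor leaves only five values of
  -- `n'`.
  have hlev : ∀ s k e, k ≤ 2 * (leadEnd s k e).lev + 1 ∧ 2 * (leadEnd s k e).lev ≤ k + 1 := by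
    intro s k e
    rcases s with s | s <;> cases e <;> simp [leadEnd, leadFst, leadSnd] <;> omega
  have h0 : leadEnd s n e = leadEnd s' n' e' := by
    rw [leadEnd_add_two_mul, leadEnd_add_two_mul] at h
    simp only [AffWeight.mk.injEq, add_left_inj] at h
    exact AffWeight.ext h.1 h.2
  have hn' : n' ∈ [(-1 : ℤ), 0, 1, 2, 3] := by
    have h1 := hlev s n e
    have h2 := hlev s' n' e'
    rw [h0] at h1
    have hn2 : n = 0 ∨ n = 1 := by simpa using hn
    simp only [List.mem_cons, List.not_mem_nil, or_false]
    omega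
  obtain ⟨σ, i, i', hR, hlow, hj⟩ := overlap_check s n hn s' n' hn' e e' h0 (by
    rintro he
    simp only [Prod.mk.injEq] at he
    exact hne (by rw [he.1, he.2]))
  set l := (leadEnd s' n' !e').lev + n with hl
  refine ⟨σ, l + 3 * m, i, i', ?_, ?_⟩
  · rw [leadEnd_add_two_mul, leadEnd_add_two_mul]
    obtain ⟨h1, ⟨h2, h3⟩, h4, h5⟩ := hR
    refine ⟨h1, ⟨?_, ?_⟩, h4, fun h => h5 ?_⟩
    · dsimp only; omega
    · dsimp only; omega
    · simp only [AffWeight.mk.injEq, add_left_inj] at h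
      exact AffWeight.ext h.1 h.2
  · intro j b
    obtain ⟨b, rfl⟩ : ∃ b', b = b' + m := ⟨b - m, by ring⟩
    rw [leadEnd_add_two_mul, leadEnd_add_two_mul, syzygySq_shift, syzygySq_shift]
    simp only [add_left_inj, add_lt_add_iff_right]
    obtain ⟨hb, hj⟩ := hj j
    by_cases hbb : -4 ≤ b ∧ b ≤ 4
    · exact hj b (by simp only [List.mem_cons, List.not_mem_nil]; omega)
    · refine Or.inr (Or.inr ?_)
      have h1 := le_six_mul_syzygySq σ l j b
      have h2 : (syzygyGen σ j b).ht = (syzygyGen σ j 0).ht + 8 * b := by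
        simp only [syzygyGen, AffWeight.ht]; ring
      have h3 : (60 : ℤ) ^ 2 ≤ (3 * (syzygyGen σ j b).ht - (8 * l + syzygyHt σ)) ^ 2 := by
        rw [sq_le_sq, h2, le_abs]
        rw [abs_of_pos (by norm_num : (0 : ℤ) < 60)]
        omega
      linarith

/-! ### The relations as coefficients of Laurent polynomials -/

noncomputable section

/-- The series `λ^α`. -/
def series (γ δ : AffWeight) (α : Weight) : LaurentPolynomial (PolyAlg γ δ) :=
  ∑ a ∈ Finset.Icc γ.lev δ.lev, AddMonoidAlgebra.single a (gen γ δ ⟨α, a⟩)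

/-- A quadric evaluated at the series `λ^α`. -/
def quadricSeries (γ δ : AffWeight) (s : Fin 5 ⊕ Fin 5) : LaurentPolynomial (PolyAlg γ δ) :=
  ((quadric s).map fun m => (m.1 : LaurentPolynomial (PolyAlg γ δ)) *
    (series γ δ m.2.1 * series γ δ m.2.2)).sum

theorem coeff_series (γ δ : AffWeight) (α : Weight) (l : ℤ) :
    (series γ δ α).coeff l = gen γ δ ⟨α, l⟩ := by
  rw [series, AddMonoidAlgebra.coeff_sum, Finsupp.finsetSum_apply]
  simp only [AddMonoidAlgebra.coeff_single, Finsupp.single_apply]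
  rw [Finset.sum_ite_eq']
  split_ifs with h
  · rfl
  · exact (gen_eq_zero h).symm

theorem coeff_series_mul (γ δ : AffWeight) (α : Weight) (p : LaurentPolynomial (PolyAlg γ δ))
    (l : ℤ) : (series γ δ α * p).coeff l =
      ∑ a ∈ Finset.Icc γ.lev δ.lev, gen γ δ ⟨α, a⟩ * p.coeff (l - a) := by
  rw [series, Finset.sum_mul, AddMonoidAlgebra.coeff_sum, Finsupp.finsetSum_apply]
  refine Finset.sum_congr rfl fun a _ => ?_
  exact AddMonoidAlgebra.coeff_single_mul_eq_mul_coeff _ fun b _ => by omega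

theorem coeff_intCast_mul {R : Type*} [CommRing R] (c : ℤ) (p : LaurentPolynomial R) (l : ℤ) :
    ((c : LaurentPolynomial R) * p).coeff l = (c : R) * p.coeff l := by
  rw [← zsmul_eq_mul, ← zsmul_eq_mul]
  rfl

theorem coeff_quadricSeries (γ δ : AffWeight) (s : Fin 5 ⊕ Fin 5) (l : ℤ) :
    (quadricSeries γ δ s).coeff l = relation γ δ s l := by
  rw [quadricSeries, relation]
  generalize quadric s = L
  induction L with
  | nil => rfl
  | cons m L ih =>
    rw [List.map_cons, List.sum_cons, AddMonoidAlgebra.coeff_add, Finsupp.add_apply, ih,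
      coeff_intCast_mul, coeff_series_mul, List.map_cons, List.sum_cons]
    simp only [coeff_series, prodCoeff]

/-- The syzygies are identities in sixteen commuting variables, so they survive substitution of the
truncated series. Comparing coefficients then gives syzygies inside every interval. -/
theorem sum_syzygy_series (γ δ : AffWeight) (σ : Fin 16) :
    ∑ i, ((syzygy σ i).1 : LaurentPolynomial (PolyAlg γ δ)) *
      (series γ δ (syzygy σ i).2.1 * quadricSeries γ δ (syzygy σ i).2.2) = 0 := by
  fin_cases σ <;> simp [Fin.sum_univ_five, syzygy, quadricSeries, quadric] <;> ring

theorem sum_syzygy (γ δ : AffWeight) (σ : Fin 16) (l : ℤ) :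
    ∑ p ∈ Finset.univ ×ˢ Finset.Icc γ.lev δ.lev, ((syzygy σ p.1).1 : PolyAlg γ δ) *
      (gen γ δ (syzygyGen σ p.1 p.2) * relation γ δ (syzygy σ p.1).2.2 (l - p.2)) = 0 := by
  have h := congrArg (fun p : LaurentPolynomial (PolyAlg γ δ) => p.coeff l)
    (sum_syzygy_series γ δ σ)
  simp only [AddMonoidAlgebra.coeff_sum, Finsupp.finsetSum_apply, coeff_intCast_mul,
    coeff_series_mul, coeff_quadricSeries] at h
  rw [Finset.sum_product]
  simpa only [Finset.mul_sum, syzygyGen, AddMonoidAlgebra.coeff_zero, Finsupp.coe_zero,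
    Pi.zero_apply] using h

/-- A relation is, up to sign, its leading monomial plus products that enclose it. -/
theorem relation_sub_mem (γ δ : AffWeight) (s : Fin 5 ⊕ Fin 5) (k : ℤ)
    (N : Submodule ℂ (PolyAlg γ δ))
    (hN : ∀ x y, Straddle (leadFst s k) (leadSnd s k) x y →
      x.ht + y.ht = (leadFst s k).ht + (leadSnd s k).ht → gen γ δ x * gen γ δ y ∈ N) :
    relation γ δ s k - ((leadTerm s k).1 : PolyAlg γ δ) *
      (gen γ δ (leadFst s k) * gen γ δ (leadSnd s k)) ∈ N := by
  obtain ⟨l₁, l₂, hq, h1, h2⟩ := exists_lead_term s k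
  have hmul : ∀ (c : ℤ) (p : PolyAlg γ δ), p ∈ N → (c : PolyAlg γ δ) * p ∈ N := by
    intro c p hp
    rw [← zsmul_eq_mul]
    exact zsmul_mem hp c
  have hgen : ∀ m ∈ quadric s, ∀ a, StraddleAt s k m a →
      gen γ δ ⟨m.2.1, a⟩ * gen γ δ ⟨m.2.2, k - a⟩ ∈ N := by
    intro m hm a h
    have hs := (ht_add_ht s k a m hm).trans (ht_lead s k).symm
    rcases h with h | h
    · exact hN _ _ h hs
    · rw [mul_comm]
      exact hN _ _ h (by rw [add_comm]; exact hs)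
  have hlist : ∀ L : List (ℤ × Weight × Weight), (∀ m ∈ L, m ∈ l₁ ++ l₂) →
      (L.map fun m => (m.1 : PolyAlg γ δ) * prodCoeff γ δ m.2.1 m.2.2 k).sum ∈ N := by
    intro L hL
    refine list_sum_mem fun p hp => ?_
    obtain ⟨m, hm, rfl⟩ := List.mem_map.1 hp
    have hm' : m ∈ quadric s := by
      have := hL m hm
      rw [hq]
      simp only [List.mem_append, List.mem_cons] at this ⊢
      tauto
    exact hmul _ _ (sum_mem fun a _ => hgen m hm' a (h2 m (hL m hm) a))
  have hlead : prodCoeff γ δ (leadTerm s k).2.1 (leadTerm s k).2.2 k -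
      gen γ δ (leadFst s k) * gen γ δ (leadSnd s k) ∈ N := by
    have hmem : leadTerm s k ∈ quadric s := leadTerm_mem s k
    have hrest : ∑ a ∈ (Finset.Icc γ.lev δ.lev).erase (leadFst s k).lev,
        gen γ δ ⟨(leadTerm s k).2.1, a⟩ * gen γ δ ⟨(leadTerm s k).2.2, k - a⟩ ∈ N :=
      sum_mem fun a ha => hgen _ hmem a (h1 a (Finset.ne_of_mem_erase ha))
    by_cases ha : (leadFst s k).lev ∈ Finset.Icc γ.lev δ.lev
    · rw [prodCoeff, ← Finset.add_sum_erase _ _ ha]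
      change gen γ δ (leadFst s k) * gen γ δ (leadSnd s k) + _ - _ ∈ N
      rwa [add_sub_cancel_left]
    · have h0 : gen γ δ (leadFst s k) = 0 := gen_eq_zero ha
      rw [h0, zero_mul, sub_zero]
      rwa [Finset.erase_eq_of_notMem ha] at hrest
  have e : relation γ δ s k - ((leadTerm s k).1 : PolyAlg γ δ) *
      (gen γ δ (leadFst s k) * gen γ δ (leadSnd s k)) =
      (l₁.map fun m => (m.1 : PolyAlg γ δ) * prodCoeff γ δ m.2.1 m.2.2 k).sum +
      ((leadTerm s k).1 : PolyAlg γ δ) *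
        (prodCoeff γ δ (leadTerm s k).2.1 (leadTerm s k).2.2 k -
          gen γ δ (leadFst s k) * gen γ δ (leadSnd s k)) +
      (l₂.map fun m => (m.1 : PolyAlg γ δ) * prodCoeff γ δ m.2.1 m.2.2 k).sum := by
    rw [relation, hq, List.map_append, List.sum_append, List.map_cons, List.sum_cons]
    ring
  rw [e]
  exact add_mem (add_mem (hlist _ fun m hm => List.mem_append_left _ hm) (hmul _ _ hlead))
    (hlist _ fun m hm => List.mem_append_right _ hm)

theorem gen_of_mem {γ δ x : AffWeight} (h : x ∈ Set.Icc γ δ) :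
    gen γ δ x = MvPolynomial.X ⟨x, h⟩ := dif_pos h

theorem gen_of_notMem {γ δ x : AffWeight} (h : x ∉ Set.Icc γ δ) : gen γ δ x = 0 := dif_neg h

/-- Intervals are convex: if a product enclosing the leading pair survives in `[γ, δ]`, so does the
leading pair. Truncation thus never leaves a relation without its leading monomial, unless it kills
the relation. -/
theorem relation_eq_zero {γ δ : AffWeight} {s : Fin 5 ⊕ Fin 5} {k : ℤ}
    (h : ¬ (leadFst s k ∈ Set.Icc γ δ ∧ leadSnd s k ∈ Set.Icc γ δ)) : relation γ δ s k = 0 := by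
  have h0 := relation_sub_mem γ δ s k ⊥ fun x y hxy _ => by
    rw [Submodule.mem_bot]
    by_contra hne
    have hx : x ∈ Set.Icc γ δ := by
      by_contra hx
      exact hne (by rw [gen_of_notMem hx, zero_mul])
    have hy : y ∈ Set.Icc γ δ := by
      by_contra hy
      exact hne (by rw [gen_of_notMem hy, mul_zero])
    exact h ⟨⟨hx.1.trans hxy.1.1, hxy.2.1.trans hy.2⟩, hx.1.trans hxy.1.2, hxy.2.2.trans hy.2⟩
  have h1 : gen γ δ (leadFst s k) * gen γ δ (leadSnd s k) = 0 := by
    rcases not_and_or.1 h with h | h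
    · rw [gen_of_notMem h, zero_mul]
    · rw [gen_of_notMem h, mul_zero]
  rwa [h1, mul_zero, sub_zero, Submodule.mem_bot] at h0

theorem leadTerm_coeff (s : Fin 5 ⊕ Fin 5) (k : ℤ) :
    (leadTerm s k).1 = 1 ∨ (leadTerm s k).1 = -1 := by
  have h : ∀ s, ∀ m ∈ quadric s, m.1 = 1 ∨ m.1 = -1 := by decide
  exact h s _ (leadTerm_mem s k)

theorem syzygy_coeff (σ : Fin 16) (i : Fin 5) : (syzygy σ i).1 = 1 ∨ (syzygy σ i).1 = -1 := by
  revert σ i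
  decide

end

/-! ### The Gröbner basis of an interval -/

noncomputable section

open MvPolynomial

/-- The labels of the relations whose leading monomial lives in the interval. -/
abbrev Rel (γ δ : AffWeight) : Type :=
  {j : (Fin 5 ⊕ Fin 5) × ℤ // leadFst j.1 j.2 ∈ Set.Icc γ δ ∧ leadSnd j.1 j.2 ∈ Set.Icc γ δ}

variable {γ δ : AffWeight}

theorem Rel.leadEnd_mem (j : Rel γ δ) (e : Bool) : leadEnd j.1.1 j.1.2 e ∈ Set.Icc γ δ := by
  cases e
  exacts [j.2.1, j.2.2]

/-- A factor of the leading monomial as an element of the interval. -/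
def Rel.leadEnd (j : Rel γ δ) (e : Bool) : Set.Icc γ δ :=
  ⟨PureSpinor.leadEnd j.1.1 j.1.2 e, j.leadEnd_mem e⟩

/-- The exponent of the leading monomial. -/
def Rel.exp (j : Rel γ δ) : Set.Icc γ δ →₀ ℕ :=
  Finsupp.single (j.leadEnd false) 1 + Finsupp.single (j.leadEnd true) 1

/-- The relation with label `j`. -/
def Rel.poly (j : Rel γ δ) : PolyAlg γ δ := relation γ δ j.1.1 j.1.2

/-- The coefficient of the leading monomial. -/
def Rel.coeff (j : Rel γ δ) : ℂ := ((leadTerm j.1.1 j.1.2).1 : ℂ)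

/-- A weight that makes the leading monomials dominant. -/
def genWeight (γ δ : AffWeight) (x : Set.Icc γ δ) : ℕ := (γ.ht ^ 2 + δ.ht ^ 2 - x.1.ht ^ 2).toNat

theorem ht_mono {x y : AffWeight} (h : x ≤ y) : x.ht ≤ y.ht := by
  rcases eq_or_ht_lt h with rfl | h
  exacts [le_rfl, h.le]

/-- A square on an interval is at most the larger of its end values, so the truncation to `ℕ` loses
nothing. -/
theorem coe_genWeight (x : Set.Icc γ δ) :
    (genWeight γ δ x : ℤ) = γ.ht ^ 2 + δ.ht ^ 2 - x.1.ht ^ 2 := by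
  refine Int.toNat_of_nonneg ?_
  have h1 := ht_mono x.2.1
  have h2 := ht_mono x.2.2
  rcases le_total 0 x.1.ht with h | h <;> nlinarith [sq_nonneg γ.ht, sq_nonneg δ.ht]

theorem Rel.exp_eq (j : Rel γ δ) (e : Bool) :
    j.exp = Finsupp.single (j.leadEnd e) 1 + Finsupp.single (j.leadEnd !e) 1 := by
  cases e
  · rfl
  · rw [Rel.exp, add_comm]; rfl

theorem weight_single (x : Set.Icc γ δ) :
    Finsupp.weight (genWeight γ δ) (Finsupp.single x 1) = genWeight γ δ x := by
  simp [Finsupp.weight_single]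

theorem Rel.weight_exp (j : Rel γ δ) :
    (Finsupp.weight (genWeight γ δ) j.exp : ℤ) = 2 * (γ.ht ^ 2 + δ.ht ^ 2) -
      ((leadFst j.1.1 j.1.2).ht ^ 2 + (leadSnd j.1.1 j.1.2).ht ^ 2) := by
  rw [Rel.exp, map_add, weight_single, weight_single]
  push_cast
  rw [coe_genWeight, coe_genWeight]
  simp only [Rel.leadEnd, PureSpinor.leadEnd]
  ring

theorem gen_mul_gen_of_mem {x y : AffWeight} (hx : x ∈ Set.Icc γ δ) (hy : y ∈ Set.Icc γ δ) :
    gen γ δ x * gen γ δ y =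
      monomial (Finsupp.single ⟨x, hx⟩ 1 + Finsupp.single ⟨y, hy⟩ 1) 1 := by
  rw [gen_of_mem hx, gen_of_mem hy, X, X, monomial_mul, one_mul]

theorem isLead_rel (γ δ : AffWeight) :
    IsLead (genWeight γ δ) (Rel.poly (γ := γ) (δ := δ)) Rel.exp Rel.coeff := by
  intro j
  constructor
  · rcases leadTerm_coeff j.1.1 j.1.2 with h | h <;> simp [Rel.coeff, h]
  · have h := relation_sub_mem γ δ j.1.1 j.1.2
      (lowWeight ℂ (genWeight γ δ) (Finsupp.weight (genWeight γ δ) j.exp)) ?_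
    · rw [gen_mul_gen_of_mem j.2.1 j.2.2] at h
      convert h using 2
      · rfl
      rw [← zsmul_eq_mul, ← map_zsmul, zsmul_eq_mul, mul_one]
      rfl
    · intro x y hxy hs
      by_cases hx : x ∈ Set.Icc γ δ
      · by_cases hy : y ∈ Set.Icc γ δ
        · rw [gen_mul_gen_of_mem hx hy]
          refine (monomial_mem_restrictSupport ℂ).2 (Or.inl ?_)
          have h1 := hxy.sq_lt hs
          have h2 := j.weight_exp
          change Finsupp.weight (genWeight γ δ) _ < _
          zify
          rw [h2, map_add, weight_single, weight_single]
          push_cast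
          rw [coe_genWeight, coe_genWeight]
          dsimp only
          linarith
        · rw [gen_of_notMem hy, mul_zero]; exact zero_mem _
      · rw [gen_of_notMem hx, zero_mul]; exact zero_mem _

theorem gen_mul_relation_mem (σ : Fin 16) (l : ℤ) (i : Fin 5) (b : ℤ) {N : ℕ}
    (hN : 3 * (γ.ht ^ 2 + δ.ht ^ 2) - syzygySq σ l i b < N) :
    gen γ δ (syzygyGen σ i b) * relation γ δ (syzygy σ i).2.2 (l - b) ∈
      lowSpan (genWeight γ δ) (Rel.poly (γ := γ) (δ := δ)) Rel.exp N := by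
  by_cases hx : syzygyGen σ i b ∈ Set.Icc γ δ
  · by_cases hr : leadFst (syzygy σ i).2.2 (l - b) ∈ Set.Icc γ δ ∧
        leadSnd (syzygy σ i).2.2 (l - b) ∈ Set.Icc γ δ
    · refine Submodule.subset_span
        ⟨Finsupp.single ⟨_, hx⟩ 1, ⟨((syzygy σ i).2.2, l - b), hr⟩, ?_, ?_⟩
      · zify
        rw [map_add, weight_single]
        push_cast
        rw [Rel.weight_exp, coe_genWeight]
        rw [syzygySq] at hN
        dsimp only
        linarith
      · rw [gen_of_mem hx]; rfl
    · rw [relation_eq_zero hr, mul_zero]; exact zero_mem _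
  · rw [gen_of_notMem hx, zero_mul]; exact zero_mem _

theorem Rel.exists_common_end {j j' : Rel γ δ} (h : ¬ Disjoint j.exp j'.exp) :
    ∃ e e', j.leadEnd e = j'.leadEnd e' := by
  by_contra hne
  push Not at hne
  apply h
  rw [disjoint_iff]
  ext x
  simp only [Finsupp.inf_apply, bot_eq_zero, Finsupp.coe_zero, Pi.zero_apply]
  by_contra h0
  have h1 : j.exp x ≠ 0 := fun h => h0 (by rw [h]; exact min_eq_left (Nat.zero_le _))
  have h2 : j'.exp x ≠ 0 := fun h => h0 (by rw [h]; exact min_eq_right (Nat.zero_le _))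
  have h3 : ∀ j : Rel γ δ, j.exp x ≠ 0 → ∃ e, j.leadEnd e = x := by
    intro j hj
    by_contra hn
    push Not at hn
    apply hj
    rw [Rel.exp, Finsupp.add_apply, Finsupp.single_eq_of_ne (hn false).symm,
      Finsupp.single_eq_of_ne (hn true).symm, add_zero]
  obtain ⟨e, he⟩ := h3 j h1
  obtain ⟨e', he'⟩ := h3 j' h2
  exact hne e e' (he.trans he'.symm)

theorem add_single_tsub {ι : Type*} {a b c : ι} (h : a ≠ c) :
    (Finsupp.single b 1 + Finsupp.single c 1 : ι →₀ ℕ) -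
      (Finsupp.single b 1 + Finsupp.single a 1) = Finsupp.single c 1 := by
  classical
  ext x
  simp only [Finsupp.coe_tsub, Finsupp.coe_add, Pi.sub_apply, Pi.add_apply, Finsupp.single_apply]
  by_cases h1 : a = x <;> by_cases h2 : c = x
  · exact absurd (h1.trans h2.symm) h
  · simp [h1, h2]
  · simp [h1, h2]
  · simp [h1, h2]

/-- Both multiples in the pair are terms of one linear syzygy. Solving the syzygy for them leaves
its other terms, whose larger sum of squared heights means lower weight. -/
theorem overlapsResolve_rel (γ δ : AffWeight) :
    OverlapsResolve (genWeight γ δ) (Rel.poly (γ := γ) (δ := δ)) Rel.exp := by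
  intro j j' hjj hd
  obtain ⟨e, e', he⟩ := Rel.exists_common_end hd
  obtain ⟨σ, l, i, i', ⟨⟨h1, h2⟩, ⟨h3, h4⟩, h5, h6⟩, hlt⟩ :=
    exists_resolves (congrArg Subtype.val he) (fun h => hjj (Subtype.ext h))
  set a := j.leadEnd !e with ha
  set c := j'.leadEnd !e' with hc
  have hac : a ≠ c := fun h => h6 (congrArg Subtype.val h)
  rw [j.exp_eq e, j'.exp_eq e', ← he, ← ha, ← hc, add_single_tsub hac, add_single_tsub hac.symm, ha,
    ← j.exp_eq e, ← ha]
  have hgc : gen γ δ (syzygyGen σ i c.1.lev) * relation γ δ (syzygy σ i).2.2 (l - c.1.lev) =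
      monomial (Finsupp.single c 1) 1 * j.poly := by
    have e1 : syzygyGen σ i c.1.lev = c.1 := by rw [syzygyGen, h1]; rfl
    have e2 : l - c.1.lev = j.1.2 := by rw [h3]; exact add_sub_cancel_left _ _
    rw [e1, e2, h1, gen_of_mem c.2]
    rfl
  have hga : gen γ δ (syzygyGen σ i' a.1.lev) * relation γ δ (syzygy σ i').2.2 (l - a.1.lev) =
      monomial (Finsupp.single a 1) 1 * j'.poly := by
    have e1 : syzygyGen σ i' a.1.lev = a.1 := by rw [syzygyGen, h2]; rfl
    have e2 : l - a.1.lev = j'.1.2 := by rw [h4]; exact add_sub_cancel_left _ _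
    rw [e1, e2, h2, gen_of_mem a.2]
    rfl
  have hW : (Finsupp.weight (genWeight γ δ) (Finsupp.single c 1 + j.exp) : ℤ) =
      3 * (γ.ht ^ 2 + δ.ht ^ 2) - syzygySq σ l i c.1.lev := by
    have e1 : syzygyGen σ i c.1.lev = c.1 := by rw [syzygyGen, h1]; rfl
    have e2 : l - c.1.lev = j.1.2 := by rw [h3]; exact add_sub_cancel_left _ _
    rw [map_add, weight_single]
    push_cast
    rw [j.weight_exp, coe_genWeight, syzygySq, e1, e2, h1]
    ring
  have hlev : ∀ x : Set.Icc γ δ, x.1.lev ∈ Finset.Icc γ.lev δ.lev := fun x =>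
    Finset.mem_Icc.2 ⟨lev_mono x.2.1, lev_mono x.2.2⟩
  have hsum := sum_syzygy γ δ σ l
  rw [← Finset.add_sum_erase _ _ (a := (i, c.1.lev)) (by simpa using hlev c),
    ← Finset.add_sum_erase _ _ (a := (i', a.1.lev))
      (by simpa [h5.symm] using hlev a)] at hsum
  simp only [hgc, hga] at hsum
  set N := Finsupp.weight (genWeight γ δ) (Finsupp.single c 1 + j.exp)
  set rest := ∑ p ∈ ((Finset.univ ×ˢ Finset.Icc γ.lev δ.lev).erase (i, c.1.lev)).erase
    (i', a.1.lev), ((syzygy σ p.1).1 : PolyAlg γ δ) *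
      (gen γ δ (syzygyGen σ p.1 p.2) * relation γ δ (syzygy σ p.1).2.2 (l - p.2)) with hrest
  have hmem : rest ∈ lowSpan (genWeight γ δ) (Rel.poly (γ := γ) (δ := δ)) Rel.exp N := by
    refine sum_mem fun p hp => ?_
    rw [← zsmul_eq_mul]
    refine zsmul_mem (gen_mul_relation_mem σ l p.1 p.2 ?_) _
    rw [hW]
    simp only [Finset.mem_erase, ne_eq, Prod.ext_iff] at hp
    rcases hlt p.1 p.2 with h | h | h
    · exact absurd h hp.2.1
    · exact absurd h hp.1
    · have h : syzygySq σ l i c.1.lev < _ := h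
      linarith
  -- The coefficients are signs, so dividing by one is multiplying by it.
  refine ⟨-((syzygy σ i).1 * (syzygy σ i').1 : ℤ), ?_⟩
  have hsq : ((syzygy σ i).1 : PolyAlg γ δ) * ((syzygy σ i).1 : PolyAlg γ δ) = 1 := by
    rcases syzygy_coeff σ i with h | h <;> simp [h]
  have key : monomial (Finsupp.single c 1) 1 * j.poly -
      (-((syzygy σ i).1 * (syzygy σ i').1 : ℤ) : ℂ) • (monomial (Finsupp.single a 1) 1 * j'.poly) =
      -(syzygy σ i).1 • rest := by
    rw [neg_smul, Int.cast_smul_eq_zsmul, zsmul_eq_mul, zsmul_eq_mul]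
    push_cast
    linear_combination (syzygy σ i).1 * hsum - monomial (Finsupp.single c 1) 1 * j.poly * hsq
  rw [key]
  exact zsmul_mem hmem _

theorem span_range_poly (γ δ : AffWeight) :
    Ideal.span (Set.range (Rel.poly (γ := γ) (δ := δ))) = relIdeal γ δ := by
  apply le_antisymm
  · refine Ideal.span_mono ?_
    rintro _ ⟨j, rfl⟩
    exact ⟨j.1, rfl⟩
  · refine Ideal.span_le.2 ?_
    rintro _ ⟨j, rfl⟩
    by_cases h : leadFst j.1 j.2 ∈ Set.Icc γ δ ∧ leadSnd j.1 j.2 ∈ Set.Icc γ δ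
    · exact Ideal.subset_span ⟨⟨j, h⟩, rfl⟩
    · dsimp only
      rw [relation_eq_zero h]
      exact zero_mem _

theorem gen_isHomogeneous (γ δ x : AffWeight) : (gen γ δ x).IsHomogeneous 1 := by
  by_cases h : x ∈ Set.Icc γ δ
  · rw [gen_of_mem h]; exact isHomogeneous_X _ _
  · rw [gen_of_notMem h]; exact isHomogeneous_zero _ _ _

theorem relation_isHomogeneous (γ δ : AffWeight) (s : Fin 5 ⊕ Fin 5) (l : ℤ) :
    (relation γ δ s l).IsHomogeneous 2 := by
  have h : relation γ δ s l ∈ homogeneousSubmodule (Set.Icc γ δ) ℂ 2 := by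
    refine list_sum_mem fun p hp => ?_
    obtain ⟨m, -, rfl⟩ := List.mem_map.1 hp
    rw [← zsmul_eq_mul]
    refine zsmul_mem (sum_mem fun a _ => ?_) _
    exact (gen_isHomogeneous _ _ _).mul (gen_isHomogeneous _ _ _)
  exact h

end

/-! ### Standard monomials, multichains and the character -/

noncomputable section

open MvPolynomial

/-- The multichains of length `n` in `D`. -/
def multichains (D : Set AffWeight) (n : ℕ) : Set (Multiset AffWeight) :=
  {S | S.card = n ∧ (∀ x ∈ S, x ∈ D) ∧ ∀ x ∈ S, ∀ y ∈ S, x ≤ y ∨ y ≤ x}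

theorem finite_Icc (γ δ : AffWeight) : (Set.Icc γ δ).Finite := by
  refine Set.Finite.of_finite_image (f := fun x => (x.cx, x.cy)) ?_ fun x _ y _ h => ?_
  · refine (Set.finite_Icc (γ.cx, γ.cy) (δ.cx, δ.cy)).subset ?_
    rintro _ ⟨x, ⟨h1, h2⟩, rfl⟩
    exact ⟨AffWeight.le_iff.1 h1, AffWeight.le_iff.1 h2⟩
  · simp only [Prod.mk.injEq] at h
    exact AffWeight.ext_coord h.1 h.2

instance (γ δ : AffWeight) : Finite (Set.Icc γ δ) := (finite_Icc γ δ).to_subtype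

variable {γ δ : AffWeight}

theorem degree_eq_of_mem_stdExp {σ J : Type*} {L : J → σ →₀ ℕ} {n : ℕ} {m : σ →₀ ℕ}
    (h : m ∈ stdExp L n) : m.degree = n := h.1

theorem finite_stdExp {σ J : Type*} [Finite σ] (L : J → σ →₀ ℕ) (n : ℕ) : (stdExp L n).Finite :=
  (Finsupp.finite_of_degree_le n).subset fun _ h => (degree_eq_of_mem_stdExp h).le

/-- The map from the span of the standard monomials of degree `n` to the component of degree `n`. -/
def stdMap (γ δ : AffWeight) (n : ℕ) :
    restrictSupport ℂ (stdExp (Rel.exp (γ := γ) (δ := δ)) n) →ₗ[ℂ] gradedPart γ δ n :=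
  (Ideal.Quotient.mkₐ ℂ (relIdeal γ δ)).toLinearMap.restrict fun p hp => by
    refine ⟨p, ?_, rfl⟩
    intro m hm
    rw [show (Finsupp.weight 1) m = m.degree by rw [Finsupp.degree_eq_weight_one]; rfl]
    exact degree_eq_of_mem_stdExp (hp (mem_support_iff.2 hm))

/-- Injectivity is Buchberger's criterion; surjectivity is reduction within a fixed degree. -/
theorem stdMap_bijective (γ δ : AffWeight) (n : ℕ) : Function.Bijective (stdMap γ δ n) := by
  constructor
  · rw [← LinearMap.ker_eq_bot, LinearMap.ker_eq_bot']
    rintro ⟨p, hp⟩ h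
    have hmem : p ∈ relIdeal γ δ := Ideal.Quotient.eq_zero_iff_mem.1 (congrArg Subtype.val h)
    rw [← span_range_poly] at hmem
    refine Subtype.ext (eq_zero_of_mem_span (isLead_rel γ δ) (overlapsResolve_rel γ δ) hmem ?_)
    intro m j
    by_contra hne
    exact (hp (mem_support_iff.2 hne)).2 j le_add_self
  · rintro ⟨_, p, hp, rfl⟩
    obtain ⟨s, hs, hps⟩ := exists_std_sub_mem_span (isLead_rel γ δ)
      (fun j => relation_isHomogeneous γ δ j.1.1 j.1.2) hp
    rw [span_range_poly] at hps
    exact ⟨⟨s, hs⟩, Subtype.ext (Ideal.Quotient.eq.2 hps).symm⟩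

/-- The basis of standard monomials of the component of degree `n`. -/
def stdBasis (γ δ : AffWeight) (n : ℕ) :
    Module.Basis (stdExp (Rel.exp (γ := γ) (δ := δ)) n) ℂ (gradedPart γ δ n) :=
  (basisRestrictSupport ℂ _).map (LinearEquiv.ofBijective _ (stdMap_bijective γ δ n))

theorem coe_stdBasis (γ δ : AffWeight) (n : ℕ) (m : stdExp (Rel.exp (γ := γ) (δ := δ)) n) :
    (stdBasis γ δ n m : RichardsonAlg γ δ) =
      Ideal.Quotient.mkₐ ℂ (relIdeal γ δ) (monomial m.1 1) := by
  have h : ((basisRestrictSupport ℂ (stdExp (Rel.exp (γ := γ) (δ := δ)) n) m :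
      restrictSupport ℂ _) : PolyAlg γ δ) = monomial m.1 1 := by
    have h1 : basisRestrictSupport ℂ (stdExp (Rel.exp (γ := γ) (δ := δ)) n) m =
        ⟨monomial m.1 1, (monomial_mem_restrictSupport ℂ).2 (Or.inl m.2)⟩ := by
      apply (basisRestrictSupport ℂ _).repr.injective
      rw [Module.Basis.repr_self]
      ext i
      change (Finsupp.single m (1 : ℂ)) i = coeff i.1 (monomial m.1 (1 : ℂ))
      classical
      rw [coeff_monomial, Finsupp.single_apply]
      simp only [Subtype.ext_iff]
    rw [h1]
  rw [stdBasis, Module.Basis.map_apply, ← h]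
  rfl

theorem polyAct_monomial (τ : SpinTorus) (q : ℂˣ) (m : Set.Icc γ δ →₀ ℕ) :
    polyAct γ δ τ q (monomial m 1) =
      (m.prod fun x k => ((τ.affE q x : ℂˣ) : ℂ) ^ k) • monomial m 1 := by
  rw [polyAct, aeval_monomial, map_one, one_mul, smul_eq_C_mul]
  simp only [mul_pow, Finsupp.prod_mul]
  rw [← prod_X_pow_eq_monomial]
  simp only [Finsupp.prod, map_prod, map_pow]

theorem gradedChar_eq_finsum (τ : SpinTorus) (q : ℂˣ) (n : ℕ) :
    gradedChar γ δ τ q n = ∑ᶠ m ∈ stdExp (Rel.exp (γ := γ) (δ := δ)) n,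
      m.prod fun x k => ((τ.affE q x : ℂˣ) : ℂ) ^ k := by
  classical
  have := (finite_stdExp (Rel.exp (γ := γ) (δ := δ)) n).fintype
  rw [gradedChar, LinearMap.trace_eq_matrix_trace ℂ (stdBasis γ δ n), Matrix.trace,
    ← finsum_set_coe_eq_finsum_mem, finsum_eq_sum_of_fintype]
  refine Finset.sum_congr rfl fun m _ => ?_
  have h : ((act γ δ τ q).toLinearMap.restrict (act_mem_gradedPart γ δ τ q n)) (stdBasis γ δ n m) =
      (m.1.prod fun x k => ((τ.affE q x : ℂˣ) : ℂ) ^ k) • stdBasis γ δ n m := by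
    apply Subtype.ext
    rw [LinearMap.coe_restrict_apply, Submodule.coe_smul, coe_stdBasis, ← map_smul,
      ← polyAct_monomial]
    rfl
  rw [Matrix.diag_apply, LinearMap.toMatrix_apply, h, map_smul, Module.Basis.repr_self,
    Finsupp.smul_apply, Finsupp.single_eq_same, smul_eq_mul, mul_one]

/-- The multiset of affine weights with given multiplicities. -/
def expMultiset (m : Set.Icc γ δ →₀ ℕ) : Multiset AffWeight :=
  (Finsupp.toMultiset m).map Subtype.val

theorem mem_expMultiset {m : Set.Icc γ δ →₀ ℕ} {x : AffWeight} :
    x ∈ expMultiset m ↔ ∃ h : x ∈ Set.Icc γ δ, m ⟨x, h⟩ ≠ 0 := by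
  classical
  simp [expMultiset, Finsupp.mem_toMultiset]

/-- Leading monomials are exactly the products of incomparable pairs, so a monomial avoids them all
if and only if its support is a chain. -/
theorem bijOn_expMultiset (γ δ : AffWeight) (n : ℕ) : Set.BijOn expMultiset
    (stdExp (Rel.exp (γ := γ) (δ := δ)) n) (multichains (Set.Icc γ δ) n) := by
  have hcard : ∀ m : Set.Icc γ δ →₀ ℕ, (expMultiset m).card = m.degree := fun m => by
    rw [expMultiset, Multiset.card_map, Finsupp.card_toMultiset]
    rfl
  have hle : ∀ (m : Set.Icc γ δ →₀ ℕ) (j : Rel γ δ),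
      j.exp ≤ m ↔ m (j.leadEnd false) ≠ 0 ∧ m (j.leadEnd true) ≠ 0 := by
    classical
    intro m j
    have hne : j.leadEnd false ≠ j.leadEnd true := fun h =>
      (incomparable_lead j.1.1 j.1.2).1 (congrArg Subtype.val h).le
    constructor
    · intro h
      have h1 := h (j.leadEnd false)
      have h2 := h (j.leadEnd true)
      simp only [Rel.exp, Finsupp.add_apply, Finsupp.single_eq_same] at h1 h2
      omega
    · rintro ⟨h1, h2⟩ x
      simp only [Rel.exp, Finsupp.add_apply, Finsupp.single_apply]
      split_ifs with h3 h4 h4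
      · exact absurd (h3.trans h4.symm) hne
      · subst h3; omega
      · subst h4; omega
      · omega
  refine ⟨?_, ?_, ?_⟩
  · rintro m ⟨hm, hstd⟩
    refine ⟨(hcard m).trans hm, fun x hx => (mem_expMultiset.1 hx).1, fun x hx y hy => ?_⟩
    obtain ⟨hx, hx'⟩ := mem_expMultiset.1 hx
    obtain ⟨hy, hy'⟩ := mem_expMultiset.1 hy
    by_contra hne
    obtain ⟨h1, h2⟩ := not_or.1 hne
    obtain ⟨s, k, ⟨rfl, rfl⟩ | ⟨rfl, rfl⟩⟩ := exists_lead_eq h1 h2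
    · exact hstd ⟨(s, k), hx, hy⟩ ((hle _ _).2 ⟨hx', hy'⟩)
    · exact hstd ⟨(s, k), hy, hx⟩ ((hle _ _).2 ⟨hy', hx'⟩)
  · intro m _ m' _ h
    classical
    exact Multiset.toFinsupp.symm.injective
      (Multiset.map_injective Subtype.val_injective h)
  · rintro S ⟨hn, hD, hchain⟩
    classical
    obtain ⟨S, rfl⟩ : ∃ S' : Multiset (Set.Icc γ δ), S'.map Subtype.val = S := by
      lift S to Multiset (Set.Icc γ δ) using hD
      exact ⟨S, rfl⟩
    have he : expMultiset (Multiset.toFinsupp S) = S.map Subtype.val := by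
      rw [expMultiset, Multiset.toFinsupp_toMultiset]
    refine ⟨Multiset.toFinsupp S, ⟨?_, fun j hj => ?_⟩, he⟩
    · rw [← hcard, he, hn]
    · rw [← he] at hchain
      obtain ⟨h1, h2⟩ := (hle _ j).1 hj
      rcases hchain _ (mem_expMultiset.2 ⟨_, h1⟩) _ (mem_expMultiset.2 ⟨_, h2⟩) with h | h
      · exact (incomparable_lead j.1.1 j.1.2).1 h
      · exact (incomparable_lead j.1.1 j.1.2).2 h

/-- The weighted number of multichains of length `n` in `D`. -/
def chainSum (u : AffWeight → ℂ) (D : Set AffWeight) (n : ℕ) : ℂ :=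
  ∑ᶠ S ∈ multichains D n, (S.map u).prod

theorem gradedChar_eq_chainSum (γ δ : AffWeight) (τ : SpinTorus) (q : ℂˣ) (n : ℕ) :
    gradedChar γ δ τ q n = chainSum (fun x => ((τ.affE q x : ℂˣ) : ℂ)) (Set.Icc γ δ) n := by
  rw [gradedChar_eq_finsum, chainSum]
  refine finsum_mem_eq_of_bijOn expMultiset (bijOn_expMultiset γ δ n) fun m hm => ?_
  clear hm
  rw [expMultiset, Multiset.map_map]
  induction m using Finsupp.induction_linear with
  | zero => simp
  | add f g hf hg =>
    rw [Finsupp.prod_add_index' (by simp) (by intros; rw [pow_add]), hf, hg, map_add,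
      Multiset.map_add, Multiset.prod_add]
  | single x k => simp [Finsupp.toMultiset_single, Multiset.map_nsmul, Multiset.prod_nsmul]

end

/-! ### Counting multichains -/

noncomputable section

theorem finite_multichains {D : Set AffWeight} (hD : D.Finite) (n : ℕ) :
    (multichains D n).Finite := by
  have h : {S : Multiset AffWeight | S.card = n ∧ ∀ x ∈ S, x ∈ D}.Finite := by
    induction n with
    | zero =>
      refine (Set.finite_singleton 0).subset fun S hS => ?_
      exact Multiset.card_eq_zero.1 hS.1
    | succ n ih =>
      refine (hD.image2 Multiset.cons ih).subset ?_
      rintro S ⟨hS, hS'⟩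
      obtain ⟨x, hx⟩ := Multiset.exists_mem_of_ne_zero (s := S) (by rintro rfl; simp at hS)
      obtain ⟨S, rfl⟩ := Multiset.exists_cons_of_mem hx
      rw [Multiset.card_cons] at hS
      exact ⟨x, hS' x (Multiset.mem_cons_self x S), S,
        ⟨by omega, fun y hy => hS' y (Multiset.mem_cons_of_mem hy)⟩, rfl⟩
  exact h.subset fun S hS => ⟨hS.1, hS.2.1⟩

theorem chainSum_zero (u : AffWeight → ℂ) (D : Set AffWeight) : chainSum u D 0 = 1 := by
  have h : multichains D 0 = {0} := by
    ext S
    constructor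
    · intro hS
      exact Multiset.card_eq_zero.1 hS.1
    · rintro rfl
      exact ⟨rfl, by simp, by simp⟩
  rw [chainSum, h, finsum_mem_singleton, Multiset.map_zero, Multiset.prod_zero]

/-- Split by whether `d` occurs. A top element is comparable with everything, so it can be added to
any multichain. -/
theorem chainSum_succ (u : AffWeight → ℂ) {D : Set AffWeight} (hD : D.Finite) {d : AffWeight}
    (hd : d ∈ D) (htop : ∀ x ∈ D, x ≤ d) (n : ℕ) :
    chainSum u D (n + 1) = u d * chainSum u D n + chainSum u (D \ {d}) (n + 1) := by
  have h : multichains D (n + 1) =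
      Multiset.cons d '' multichains D n ∪ multichains (D \ {d}) (n + 1) := by
    ext S
    constructor
    · rintro ⟨h1, h2, h3⟩
      by_cases hS : d ∈ S
      · left
        obtain ⟨S, rfl⟩ := Multiset.exists_cons_of_mem hS
        rw [Multiset.card_cons] at h1
        exact ⟨S, ⟨by omega, fun x hx => h2 x (Multiset.mem_cons_of_mem hx), fun x hx y hy =>
          h3 x (Multiset.mem_cons_of_mem hx) y (Multiset.mem_cons_of_mem hy)⟩, rfl⟩
      · right
        exact ⟨h1, fun x hx => ⟨h2 x hx, by rintro rfl; exact hS hx⟩, h3⟩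
    · rintro (⟨S, ⟨h1, h2, h3⟩, rfl⟩ | ⟨h1, h2, h3⟩)
      · have h2' : ∀ x ∈ d ::ₘ S, x ∈ D := by
          intro x hx
          rcases Multiset.mem_cons.1 hx with rfl | hx
          exacts [hd, h2 x hx]
        refine ⟨by rw [Multiset.card_cons, h1], h2', fun x hx y hy => ?_⟩
        rcases Multiset.mem_cons.1 hx with rfl | hx'
        · exact Or.inr (htop y (h2' y hy))
        rcases Multiset.mem_cons.1 hy with rfl | hy'
        · exact Or.inl (htop x (h2' x hx))
        exact h3 x hx' y hy'
      · exact ⟨h1, fun x hx => (h2 x hx).1, h3⟩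
  have hdisj : Disjoint (Multiset.cons d '' multichains D n) (multichains (D \ {d}) (n + 1)) := by
    rw [Set.disjoint_left]
    rintro _ ⟨S, -, rfl⟩ ⟨-, h2, -⟩
    exact (h2 d (Multiset.mem_cons_self d S)).2 rfl
  rw [chainSum, h, finsum_mem_union hdisj ((finite_multichains hD n).image _)
      (finite_multichains (hD.subset Set.sdiff_subset) _),
    finsum_mem_image (fun S _ S' _ h => (Multiset.cons_inj_right d).1 h), chainSum, chainSum,
    mul_finsum_mem]
  simp only [Multiset.map_cons, Multiset.prod_cons]

/-- By the hypotheses no element of `D₁ \ D₂` is comparable with one of `D₂ \ D₁`. Each multichain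
of the union lies in one part, and inclusion-exclusion applies. -/
theorem chainSum_union (u : AffWeight → ℂ) {D₁ D₂ : Set AffWeight} (h₁ : D₁.Finite) (h₂ : D₂.Finite)
    (h₁₂ : ∀ x ∈ D₁, ∀ y ∈ D₂, x ≤ y → x ∈ D₂) (h₂₁ : ∀ x ∈ D₂, ∀ y ∈ D₁, x ≤ y → x ∈ D₁) (n : ℕ) :
    chainSum u (D₁ ∪ D₂) n + chainSum u (D₁ ∩ D₂) n = chainSum u D₁ n + chainSum u D₂ n := by
  have hU : multichains (D₁ ∪ D₂) n = multichains D₁ n ∪ multichains D₂ n := by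
    ext S
    constructor
    · rintro ⟨h1, h2, h3⟩
      by_contra hne
      have ha : ∃ x ∈ S, x ∉ D₁ := by
        by_contra ha
        push Not at ha
        exact hne (Or.inl ⟨h1, ha, h3⟩)
      have hb : ∃ x ∈ S, x ∉ D₂ := by
        by_contra hb
        push Not at hb
        exact hne (Or.inr ⟨h1, hb, h3⟩)
      obtain ⟨x, hx, hx1⟩ := ha
      obtain ⟨y, hy, hy2⟩ := hb
      have hx2 := (h2 x hx).resolve_left hx1
      have hy1 := (h2 y hy).resolve_right hy2
      rcases h3 x hx y hy with h | h
      · exact hx1 (h₂₁ x hx2 y hy1 h)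
      · exact hy2 (h₁₂ y hy1 x hx2 h)
    · rintro (⟨h1, h2, h3⟩ | ⟨h1, h2, h3⟩)
      · exact ⟨h1, fun x hx => Or.inl (h2 x hx), h3⟩
      · exact ⟨h1, fun x hx => Or.inr (h2 x hx), h3⟩
  have hI : multichains (D₁ ∩ D₂) n = multichains D₁ n ∩ multichains D₂ n := by
    ext S
    constructor
    · rintro ⟨h1, h2, h3⟩
      exact ⟨⟨h1, fun x hx => (h2 x hx).1, h3⟩, h1, fun x hx => (h2 x hx).2, h3⟩
    · rintro ⟨⟨h1, h2, h3⟩, -, h2', -⟩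
      exact ⟨h1, fun x hx => ⟨h2 x hx, h2' x hx⟩, h3⟩
  rw [chainSum, chainSum, hU, hI,
    finsum_mem_union_inter (finite_multichains h₁ n) (finite_multichains h₂ n)]
  rfl

/-- The generating function of the multichains in an interval. -/
def chainSeries (u : AffWeight → ℂ) (γ δ : AffWeight) : PowerSeries ℂ :=
  PowerSeries.mk (chainSum u (Set.Icc γ δ))

theorem chainSeries_mul (u : AffWeight → ℂ) {γ δ : AffWeight} (h : γ ≤ δ) :
    chainSeries u γ δ * (1 - PowerSeries.C (u δ) * PowerSeries.X) =
      PowerSeries.mk (chainSum u (Set.Ico γ δ)) := by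
  have hI : Set.Icc γ δ \ {δ} = Set.Ico γ δ := by
    ext x
    simp only [Set.mem_sdiff, Set.mem_Icc, Set.mem_Ico, Set.mem_singleton_iff, lt_iff_le_and_ne]
    tauto
  ext n
  rw [mul_sub, mul_one, mul_left_comm, ← mul_assoc, map_sub]
  cases n with
  | zero => simp [chainSeries, chainSum_zero]
  | succ n =>
    rw [PowerSeries.coeff_succ_mul_X, PowerSeries.coeff_C_mul, chainSeries, PowerSeries.coeff_mk,
      PowerSeries.coeff_mk, PowerSeries.coeff_mk,
      chainSum_succ u (finite_Icc γ δ) (Set.right_mem_Icc.2 h) (fun x hx => hx.2), hI]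
    ring

/-- `x` is the only lower cover of `δ`. -/
def OneCover (δ x : AffWeight) : Prop := ∀ z, z < δ ↔ z ≤ x

/-- `x` and `y` are the lower covers of `δ`, with meet `m`. -/
def TwoCovers (δ x y m : AffWeight) : Prop :=
  (∀ z, z < δ ↔ z ≤ x ∨ z ≤ y) ∧ ∀ z, z ≤ m ↔ z ≤ x ∧ z ≤ y

theorem OneCover.lt {δ x : AffWeight} (h : OneCover δ x) : x < δ := (h x).2 le_rfl

theorem OneCover.chainSeries_mul {u : AffWeight → ℂ} {γ δ x : AffWeight} (h : OneCover δ x)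
    (hγ : γ ≤ δ) : chainSeries u γ δ * (1 - PowerSeries.C (u δ) * PowerSeries.X) =
      chainSeries u γ x := by
  rw [PureSpinor.chainSeries_mul u hγ, chainSeries]
  congr 2
  ext z
  exact and_congr_right fun _ => h z

theorem TwoCovers.chainSeries_mul {u : AffWeight → ℂ} {γ δ x y m : AffWeight}
    (h : TwoCovers δ x y m) (hγ : γ ≤ δ) :
    chainSeries u γ δ * (1 - PowerSeries.C (u δ) * PowerSeries.X) =
      chainSeries u γ x + chainSeries u γ y - chainSeries u γ m := by
  rw [PureSpinor.chainSeries_mul u hγ, eq_sub_iff_add_eq]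
  have hU : Set.Ico γ δ = Set.Icc γ x ∪ Set.Icc γ y := by
    ext z
    simp only [Set.mem_Ico, Set.mem_union, Set.mem_Icc, h.1 z]
    tauto
  have hI : Set.Icc γ m = Set.Icc γ x ∩ Set.Icc γ y := by
    ext z
    simp only [Set.mem_Icc, Set.mem_inter_iff, h.2 z]
    tauto
  ext n
  simp only [chainSeries, map_add, PowerSeries.coeff_mk, hU, hI]
  exact chainSum_union u (finite_Icc γ x) (finite_Icc γ y)
    (fun a ha b hb hab => ⟨ha.1, hab.trans hb.2⟩) (fun a ha b hb hab => ⟨ha.1, hab.trans hb.2⟩) n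

/-! ### Ladders and the recursion -/

/-- The configuration of affine weights behind each of the recursion formulas. -/
structure Ladder (t₁ t₂ t₃ b₁ b₂ b₃ e f g : AffWeight) : Prop where
  t₁ : OneCover t₁ t₂
  t₂ : OneCover t₂ t₃
  t₃ : TwoCovers t₃ e b₂ b₃
  b₁ : OneCover b₁ b₂
  b₂ : OneCover b₂ b₃
  e : TwoCovers e b₃ f g
  f : OneCover f g

/-- Elimination among seven cover relations. With `d` the scalar of `e`, multiplying the relation
for `t₃` by `1 - d * X` and using those for `e` and `f` leaves the term of `f` plus `B₂ - d * X *
(B₂ - B₃)`. The relation for `b₂` turns this difference into a multiple of `B₂`, and `B₂` is a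
multiple of `B₁`. -/
theorem Ladder.recursion {t₁ t₂ t₃ b₁ b₂ b₃ e f g : AffWeight}
    (h : Ladder t₁ t₂ t₃ b₁ b₂ b₃ e f g) (u : AffWeight → ℂ) {γ : AffWeight} (hγ : γ < f) :
    chainSeries u γ t₁ * ((1 - PowerSeries.C (u t₃) * PowerSeries.X) *
      (1 - PowerSeries.C (u t₂) * PowerSeries.X) * (1 - PowerSeries.C (u t₁) * PowerSeries.X) *
      (1 - PowerSeries.C (u e) * PowerSeries.X)) =
      (1 - PowerSeries.C (u b₁) * PowerSeries.X) *
        (1 - PowerSeries.C (u b₂) * PowerSeries.C (u e) * PowerSeries.X ^ 2) *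
        chainSeries u γ b₁ + PowerSeries.C (u f) * PowerSeries.X * chainSeries u γ f := by
  -- Strictness of `γ < f` is needed here: `g` is the lowest element of the ladder, and all the
  -- cover relations hold once `γ` is below it.
  have hg : γ ≤ g := (h.f γ).1 hγ
  have hb₃ : γ ≤ b₃ := hg.trans ((h.e.2 g).1 le_rfl).1
  have hb₂ : γ ≤ b₂ := hb₃.trans h.b₂.lt.le
  have hb₁ : γ ≤ b₁ := hb₂.trans h.b₁.lt.le
  have he : γ ≤ e := ((h.e.1 γ).2 (Or.inl hb₃)).le
  have ht₃ : γ ≤ t₃ := ((h.t₃.1 γ).2 (Or.inl he)).le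
  have ht₂ : γ ≤ t₂ := ht₃.trans h.t₂.lt.le
  have ht₁ : γ ≤ t₁ := ht₂.trans h.t₁.lt.le
  have e1 := h.t₁.chainSeries_mul (u := u) ht₁
  have e2 := h.t₂.chainSeries_mul (u := u) ht₂
  have e3 := h.t₃.chainSeries_mul (u := u) ht₃
  have e4 := h.b₁.chainSeries_mul (u := u) hb₁
  have e5 := h.b₂.chainSeries_mul (u := u) hb₂
  have e6 := h.e.chainSeries_mul (u := u) he
  have e7 := h.f.chainSeries_mul (u := u) hγ.le
  generalize chainSeries u γ t₁ = T₁ at *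
  generalize chainSeries u γ t₂ = T₂ at *
  generalize chainSeries u γ t₃ = T₃ at *
  generalize chainSeries u γ b₁ = B₁ at *
  generalize chainSeries u γ b₂ = B₂ at *
  generalize chainSeries u γ b₃ = B₃ at *
  generalize chainSeries u γ e = E at *
  generalize chainSeries u γ f = F at *
  generalize chainSeries u γ g = G at *
  generalize (PowerSeries.C (u t₁) : PowerSeries ℂ) = a₁ at *
  generalize (PowerSeries.C (u t₂) : PowerSeries ℂ) = a₂ at *
  generalize (PowerSeries.C (u t₃) : PowerSeries ℂ) = a₃ at *
  generalize (PowerSeries.C (u b₁) : PowerSeries ℂ) = c₁ at *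
  generalize (PowerSeries.C (u b₂) : PowerSeries ℂ) = c₂ at *
  generalize (PowerSeries.C (u e) : PowerSeries ℂ) = d at *
  generalize (PowerSeries.C (u f) : PowerSeries ℂ) = k at *
  generalize (PowerSeries.X : PowerSeries ℂ) = X at *
  subst e1 e2 e4 e7
  linear_combination (1 - d * X) * e3 + e6 - d * X * e5

theorem AffWeight.lt_iff {x y : AffWeight} :
    x < y ↔ (x.cx ≤ y.cx ∧ x.cy ≤ y.cy) ∧ (x.cx < y.cx ∨ x.cy < y.cy) := by
  rw [lt_iff_le_and_ne, AffWeight.le_iff]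
  refine and_congr_right fun h => ⟨fun hne => ?_, ?_⟩
  · by_contra hc
    exact hne (AffWeight.ext_coord (by omega) (by omega))
  · rintro hc rfl
    omega

/-- Turns a cover relation into linear arithmetic on the points of the strip. -/
theorem oneCover_of_forall {δ x : AffWeight}
    (h : ∀ i j : ℤ, 2 * ((i + 1) / 2) ≤ j → j ≤ 2 * ((i + 1) / 2) + 3 →
      ((i ≤ δ.cx ∧ j ≤ δ.cy) ∧ (i < δ.cx ∨ j < δ.cy) ↔ i ≤ x.cx ∧ j ≤ x.cy)) : OneCover δ x := by
  intro z
  rw [AffWeight.lt_iff, AffWeight.le_iff]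
  exact h _ _ z.strip.1 z.strip.2

theorem twoCovers_of_forall {δ x y m : AffWeight}
    (h : ∀ i j : ℤ, 2 * ((i + 1) / 2) ≤ j → j ≤ 2 * ((i + 1) / 2) + 3 →
      ((i ≤ δ.cx ∧ j ≤ δ.cy) ∧ (i < δ.cx ∨ j < δ.cy) ↔
        (i ≤ x.cx ∧ j ≤ x.cy) ∨ (i ≤ y.cx ∧ j ≤ y.cy)) ∧
      ((i ≤ m.cx ∧ j ≤ m.cy) ↔ (i ≤ x.cx ∧ j ≤ x.cy) ∧ (i ≤ y.cx ∧ j ≤ y.cy))) :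
    TwoCovers δ x y m := by
  constructor <;> intro z
  · rw [AffWeight.lt_iff, AffWeight.le_iff, AffWeight.le_iff]
    exact (h _ _ z.strip.1 z.strip.2).1
  · rw [AffWeight.le_iff, AffWeight.le_iff, AffWeight.le_iff]
    exact (h _ _ z.strip.1 z.strip.2).2

theorem ladder_p5 (r : ℤ) : Ladder ⟨p5, r⟩ ⟨w34, r⟩ ⟨w24, r⟩ ⟨w15, r⟩ ⟨w14, r⟩ ⟨w13, r⟩ ⟨w23, r⟩
    ⟨p1, r - 1⟩ ⟨p2, r - 1⟩ := by
  constructor <;> first | apply oneCover_of_forall | apply twoCovers_of_forall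
  all_goals
    simp only [AffWeight.cx, AffWeight.cy, Weight.cx, Weight.cy]
    intro i j h1 h2
    omega

theorem ladder_w15 (r : ℤ) : Ladder ⟨w15, r⟩ ⟨w14, r⟩ ⟨w13, r⟩ ⟨p1, r - 1⟩ ⟨p2, r - 1⟩
    ⟨p3, r - 1⟩ ⟨w12, r⟩ ⟨o, r⟩ ⟨w45, r - 1⟩ := by
  constructor <;> first | apply oneCover_of_forall | apply twoCovers_of_forall
  all_goals
    simp only [AffWeight.cx, AffWeight.cy, Weight.cx, Weight.cy]
    intro i j h1 h2
    omega

theorem ladder_p1 (r : ℤ) : Ladder ⟨p1, r⟩ ⟨p2, r⟩ ⟨p3, r⟩ ⟨o, r + 1⟩ ⟨w45, r⟩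
    ⟨w35, r⟩ ⟨p4, r⟩ ⟨p5, r⟩ ⟨w34, r⟩ := by
  constructor <;> first | apply oneCover_of_forall | apply twoCovers_of_forall
  all_goals
    simp only [AffWeight.cx, AffWeight.cy, Weight.cx, Weight.cy]
    intro i j h1 h2
    omega

theorem ladder_o (r : ℤ) : Ladder ⟨o, r⟩ ⟨w45, r - 1⟩ ⟨w35, r - 1⟩ ⟨p5, r - 1⟩ ⟨w34, r - 1⟩
    ⟨w24, r - 1⟩ ⟨w25, r - 1⟩ ⟨w15, r - 1⟩ ⟨w14, r - 1⟩ := by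
  constructor <;> first | apply oneCover_of_forall | apply twoCovers_of_forall
  all_goals
    simp only [AffWeight.cx, AffWeight.cy, Weight.cx, Weight.cy]
    intro i j h1 h2
    omega

/-! ### Translation to torus characters -/

theorem poincare_eq_chainSeries (γ δ : AffWeight) (τ : SpinTorus) (q : ℂˣ) :
    poincare γ δ τ q = chainSeries (fun x => ((τ.affE q x : ℂˣ) : ℂ)) γ δ := by
  ext n
  simp only [poincare, chainSeries, PowerSeries.coeff_mk, gradedChar_eq_chainSum]

theorem C_affE (τ : SpinTorus) (q : ℂˣ) (α : Weight) (l : ℤ) :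
    PowerSeries.C ((τ.affE q ⟨α, l⟩ : ℂˣ) : ℂ) = Q q l * τ.E α := by
  rw [SpinTorus.affE, Units.val_mul, map_mul, Units.val_zpow_eq_zpow_val]

/-- Writes all powers of `q` as monomials in two of them, so that the formulas become polynomial
identities. -/
theorem Q_eq_pow_mul_pow (q : ℂˣ) {n : ℤ} (r : ℤ) (a b : ℕ) (h : n = a * r + b) :
    Q q n = Q q r ^ a * Q q 1 ^ b := by
  rw [← map_pow, ← map_pow, ← map_mul, h, Q, zpow_add₀ q.ne_zero, mul_comm (a : ℤ), zpow_mul,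
    zpow_natCast, zpow_natCast, zpow_one]

theorem eq_add_of_mul_eq {P D M N A B : PowerSeries ℂ} (hD : PowerSeries.constantCoeff D ≠ 0)
    (h : P * D = M * A + N * B) : P = M * D⁻¹ * A + N * D⁻¹ * B := by
  have hi := PowerSeries.mul_inv_cancel D hD
  linear_combination D⁻¹ * h - P * hi

end

end PureSpinor

open PureSpinor

theorem propositionE (τ : SpinTorus) (q : ℂˣ) (r : ℤ) (γ : AffWeight) :
    (γ < ⟨.p1, r - 1⟩ →
      poincare γ ⟨.p5, r⟩ τ q =
        (1 - τ.E .w15 * Q q r * t - τ.E .w14 * τ.E .w23 * Q q (2 * r) * t ^ 2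
            + τ.E .w15 * τ.E .w14 * τ.E .w23 * Q q (3 * r) * t ^ 3)
          * ((1 - τ.E .w24 * Q q r * t) * (1 - τ.E .w34 * Q q r * t) * (1 - τ.E .p5 * Q q r * t)
            * (1 - τ.E .w23 * Q q r * t))⁻¹ * poincare γ ⟨.w15, r⟩ τ q
        + τ.E .p1 * Q q (r - 1) * t
          * ((1 - τ.E .w24 * Q q r * t) * (1 - τ.E .w34 * Q q r * t) * (1 - τ.E .p5 * Q q r * t)
            * (1 - τ.E .w23 * Q q r * t))⁻¹ * poincare γ ⟨.p1, r - 1⟩ τ q) ∧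
    (γ < ⟨.o, r⟩ →
      poincare γ ⟨.w15, r⟩ τ q =
        (1 - τ.E .p1 * Q q (r - 1) * t - τ.E .p2 * τ.E .w12 * Q q (2 * r - 1) * t ^ 2
            + τ.E .p1 * τ.E .p2 * τ.E .w12 * Q q (3 * r - 2) * t ^ 3)
          * ((1 - τ.E .w13 * Q q r * t) * (1 - τ.E .w14 * Q q r * t) * (1 - τ.E .w15 * Q q r * t)
            * (1 - τ.E .w12 * Q q r * t))⁻¹ * poincare γ ⟨.p1, r - 1⟩ τ q
        + τ.E .o * Q q r * t
          * ((1 - τ.E .w13 * Q q r * t) * (1 - τ.E .w14 * Q q r * t) * (1 - τ.E .w15 * Q q r * t)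
            * (1 - τ.E .w12 * Q q r * t))⁻¹ * poincare γ ⟨.o, r⟩ τ q) ∧
    (γ < ⟨.p5, r⟩ →
      poincare γ ⟨.p1, r⟩ τ q =
        (1 - τ.E .o * Q q (r + 1) * t - τ.E .w45 * τ.E .p4 * Q q (2 * r) * t ^ 2
            + τ.E .o * τ.E .w45 * τ.E .p4 * Q q (3 * r + 1) * t ^ 3)
          * ((1 - τ.E .p3 * Q q r * t) * (1 - τ.E .p2 * Q q r * t) * (1 - τ.E .p1 * Q q r * t)
            * (1 - τ.E .p4 * Q q r * t))⁻¹ * poincare γ ⟨.o, r + 1⟩ τ q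
        + τ.E .p5 * Q q r * t
          * ((1 - τ.E .p3 * Q q r * t) * (1 - τ.E .p2 * Q q r * t) * (1 - τ.E .p1 * Q q r * t)
            * (1 - τ.E .p4 * Q q r * t))⁻¹ * poincare γ ⟨.p5, r⟩ τ q) ∧
    (γ < ⟨.w15, r - 1⟩ →
      poincare γ ⟨.o, r⟩ τ q =
        (Q q 3 - Q q (2 + r) * τ.E .p5 * t - Q q (2 * r + 1) * τ.E .w34 * τ.E .w25 * t ^ 2
            + Q q (3 * r) * τ.E .w34 * τ.E .p5 * τ.E .w25 * t ^ 3)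
          * ((Q q 1 - τ.E .w35 * Q q r * t) * (Q q 1 - τ.E .w45 * Q q r * t) * (1 - τ.E .o * Q q r * t)
            * (Q q 1 - τ.E .w25 * Q q r * t))⁻¹ * poincare γ ⟨.p5, r - 1⟩ τ q
        + Q q (2 + r) * τ.E .w15 * t
          * ((Q q 1 - τ.E .w35 * Q q r * t) * (Q q 1 - τ.E .w45 * Q q r * t) * (1 - τ.E .o * Q q r * t)
            * (Q q 1 - τ.E .w25 * Q q r * t))⁻¹ * poincare γ ⟨.w15, r - 1⟩ τ q) := by
  simp only [poincare_eq_chainSeries]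
  refine ⟨fun h => eq_add_of_mul_eq ?_ ?_, fun h => eq_add_of_mul_eq ?_ ?_,
    fun h => eq_add_of_mul_eq ?_ ?_, fun h => eq_add_of_mul_eq ?_ ?_⟩
  · simp
  · have := (ladder_p5 r).recursion (fun x => ((τ.affE q x : ℂˣ) : ℂ)) h
    simp only [C_affE] at this
    rw [Q_eq_pow_mul_pow q r 2 0 (n := 2 * r) (by push_cast; ring),
      Q_eq_pow_mul_pow q r 3 0 (n := 3 * r) (by push_cast; ring)]
    linear_combination this
  · simp
  · have := (ladder_w15 r).recursion (fun x => ((τ.affE q x : ℂˣ) : ℂ)) h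
    simp only [C_affE] at this
    -- The base `r - 1` keeps the exponents natural: `3 * r - 2 = 3 * (r - 1) + 1`.
    rw [Q_eq_pow_mul_pow q (r - 1) 1 1 (n := r) (by push_cast; ring)] at this ⊢
    rw [Q_eq_pow_mul_pow q (r - 1) 2 1 (n := 2 * r - 1) (by push_cast; ring),
      Q_eq_pow_mul_pow q (r - 1) 3 1 (n := 3 * r - 2) (by push_cast; ring)]
    linear_combination this
  · simp
  · have := (ladder_p1 r).recursion (fun x => ((τ.affE q x : ℂˣ) : ℂ)) h
    simp only [C_affE] at this
    rw [Q_eq_pow_mul_pow q r 1 1 (n := r + 1) (by push_cast; ring)] at this ⊢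
    rw [Q_eq_pow_mul_pow q r 2 0 (n := 2 * r) (by push_cast; ring),
      Q_eq_pow_mul_pow q r 3 1 (n := 3 * r + 1) (by push_cast; ring)]
    linear_combination this
  · simp
  · have := (ladder_o r).recursion (fun x => ((τ.affE q x : ℂˣ) : ℂ)) h
    simp only [C_affE] at this
    rw [Q_eq_pow_mul_pow q (r - 1) 1 1 (n := r) (by push_cast; ring)] at this ⊢
    rw [Q_eq_pow_mul_pow q (r - 1) 0 3 (n := 3) (by push_cast; ring),
      Q_eq_pow_mul_pow q (r - 1) 1 3 (n := 2 + r) (by push_cast; ring),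
      Q_eq_pow_mul_pow q (r - 1) 2 3 (n := 2 * r + 1) (by push_cast; ring),
      Q_eq_pow_mul_pow q (r - 1) 3 3 (n := 3 * r) (by push_cast; ring)]
    -- Three denominator factors are `q` times `1` minus a level `r - 1` scalar times `t`, so this
    -- formula is the ladder identity scaled by `q ^ 3`.
    linear_combination Q q 1 ^ 3 * this
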